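/- Let $r\ge 2$. Let $J\subset\mathbb Z$ be the set of hops, $J=\{-\frac{r-1}2,\dots,\frac{r-1}2\}$ for odd $r$ and $J=\{-\frac r2,\dots,-1,1,\dots,\frac r2\}$ for even $r$, and let $p_j>0$ ($j\in J$) with $\sum_{j\in J}p_j=1$. Put $x_j=\sum_{i<j}p_i$ and $y_j=\sum_{i<j}p_{-i}$ (sums over $i\in J$). The $r$-adic multi-baker map on $\mathbb Z\times[0,1)^2$ is $$B(n,x,y)=\Big(n+j,\ \frac{x-x_j}{p_j},\ y_j+p_{-j}\,y\Big)\qquad\text{for } x_j\le x<x_j+p_j,\ j\in J.$$ Let $\chi_k=\sum_{j}p_je^{-ikj}$, $\mathcal D=\frac12\sum_j j^2p_j-\frac12\big(\sum_j jp_j\big)^2$ (diffusion coefficient) and $\lambda^+=\sum_j p_j\ln(1/p_j)$ (positive Lyapunov exponent). Call a continuous $F:[0,1]\to\mathbb C$ with $F(0)=0$, $F(1)=1$ a cumulative function of the hydrodynamic mode of wavenumber $k$ if the additive set function $\mu$ on rectangles given by $\mu(\{n\}\times[a,b)\times[c,d))=e^{ikn}(b-a)(F(d)-F(c))$ satisfies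 $\mu(B^{-1}\Omega)=\chi_k\,\mu(\Omega)$ for all rectangles $\Omega$ whose preimage is a rectangle (every rectangle is a finite disjoint union of such). There is $k_0>0$ such that for all real $k$ with $|k|<k_0$: $p_j<|\chi_k|$ for all $j$; there is exactly one cumulative function $F_k$ of the hydrodynamic mode of wavenumber $k$; and $F_k$ is also the unique continuous function on $[0,1]$ with $F_k(1)=1$ that solves the de Rham-type equation $$F_k(y)=\sum_{i<j}\frac{p_i}{\chi_k}e^{-iki}+\frac{p_j}{\chi_k}e^{-ikj}\,F_k\Big(\frac{y-y_j}{p_{-j}}\Big),\qquad y_j\le y<y_j+p_{-j},\ j\in J$$ (in the exponents $e^{-iki}$ the first $i$ is the imaginary unit, the second the summation index). As $k\to0$, the Hausdorff dimension of the curve $F_k([0,1])\subset\mathbb C$ is $$D_H(k)=1+\frac{\mathcal D}{\lambda^+}k^2+O(k^4).$$ Moreover, for $|k|<k_0$ the cylinder sums $\Gamma^s_l=\sum_{\omega_1,\dots,\omega_l\in J}|\Delta F_k[y(\omega_1,\dots,\omega_l)]|^s$, where $\Delta F_k$ is the difference of the values of $F_k$ at the two end points of the cylinder interval of the word $\omega_1\dots\omega_l$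 in the $y$ direction, have a critical exponent $d(k)$ (for $l\to\infty$, $\Gamma^s_l\to\infty$ if $s<d(k)$ and $\Gamma^s_l\to0$ if $s>d(k)$); it satisfies $|\chi_k|^{d(k)}=\sum_jp_j^{d(k)}$ and $d(k)=1+\frac{\mathcal D}{\lambda^+}k^2+O(k^4)$ as well. -/

import Mathlib

open Filter Topology Asymptotics Set

noncomputable section

namespace MultiBaker

/-- The hops of an `r`-adic random walk, in increasing order of the `r` symbols:
`-(r-1)/2, …, (r-1)/2` for odd `r`, and `-r/2, …, -1, 1, …, r/2` for even `r`
(the hop `0` is excluded when `r` is even). -/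
def hops (r : ℕ) : Finset ℤ :=
  if Odd r then Finset.Icc (-((r / 2 : ℕ) : ℤ)) ((r / 2 : ℕ) : ℤ)
  else (Finset.Icc (-((r / 2 : ℕ) : ℤ)) ((r / 2 : ℕ) : ℤ)).erase 0

/-- The hops smaller than `j`. -/
def below (r : ℕ) (j : ℤ) : Finset ℤ := (hops r).filter (fun i => i < j)

/-- Left end of the vertical strip of hop `j`; the strip has width `p j`. -/
def xLeft (r : ℕ) (p : ℤ → ℝ) (j : ℤ) : ℝ := ∑ i ∈ below r j, p i

/-- Lower end of the horizontal strip of hop `j`; the strip has height `p (-j)`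
(reversed order of the probabilities along `y`). -/
def yLeft (r : ℕ) (p : ℤ → ℝ) (j : ℤ) : ℝ := ∑ i ∈ below r j, p (-i)

/-- The hop `j` whose vertical strip contains `x`, for `0 ≤ x < 1`
(the strips are disjoint, so that at most one term is not zero). -/
def hopAt (r : ℕ) (p : ℤ → ℝ) (x : ℝ) : ℤ :=
  ∑ j ∈ hops r, if xLeft r p j ≤ x ∧ x < xLeft r p j + p j then j else 0

/-- The `r`-adic multi-baker map `(n, x, y) ↦ (n + j, (x - xLeft j) / p j, yLeft j + p (-j) y)`
for `x` in the vertical strip of hop `j`. -/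
def bakerMap (r : ℕ) (p : ℤ → ℝ) (z : ℤ × ℝ × ℝ) : ℤ × ℝ × ℝ :=
  (z.1 + hopAt r p z.2.1,
    (z.2.1 - xLeft r p (hopAt r p z.2.1)) / p (hopAt r p z.2.1),
    yLeft r p (hopAt r p z.2.1) + p (-(hopAt r p z.2.1)) * z.2.2)

/-- The phase space `ℤ × [0,1)²`. -/
def phase : Set (ℤ × ℝ × ℝ) := univ ×ˢ (Ico (0 : ℝ) 1 ×ˢ Ico (0 : ℝ) 1)

/-- A rectangle (cylinder) `[a,b) × [c,d)` in cell `n`. -/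
def rect (n : ℤ) (a b c d : ℝ) : Set (ℤ × ℝ × ℝ) := {n} ×ˢ (Ico a b ×ˢ Ico c d)

/-- The eigenvalue `χ_k = ∑ p_j exp(-i k j)`. -/
def chi (r : ℕ) (p : ℤ → ℝ) (k : ℝ) : ℂ :=
  ∑ j ∈ hops r, (p j : ℂ) * Complex.exp (-(Complex.I * k * j))

/-- The amount that the mode of wavenumber `k`, uniform in `x` and with cumulative function
`F` in `y`, gives to the rectangle `[a,b) × [c,d)` of cell `n`. -/
def modeCharge (k : ℝ) (F : ℝ → ℂ) (n : ℤ) (a b c d : ℝ) : ℂ :=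
  Complex.exp (Complex.I * k * n) * ((b - a : ℝ) : ℂ) * (F d - F c)

/-- `F` is the (normalized, continuous) cumulative function of the hydrodynamic mode of
wavenumber `k` of the multi-baker map `B`: the additive set function `μ` on rectangles with
`μ ({n} × [0,x) × [0,y)) = exp(i k n) x F(y)` satisfies `μ (B⁻¹ Ω) = χ_k μ (Ω)` for all
rectangles `Ω` whose preimage is a rectangle (those inside one horizontal strip; every other
rectangle is a finite disjoint union of such ones). -/
def IsHydrodynamicMode (r : ℕ) (p : ℤ → ℝ) (k : ℝ) (F : ℝ → ℂ) : Prop :=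
  ContinuousOn F (Icc 0 1) ∧ F 0 = 0 ∧ F 1 = 1 ∧
    ∀ (n m : ℤ) (a b c d a' b' c' d' : ℝ),
      0 ≤ a → a ≤ b → b ≤ 1 → 0 ≤ c → c ≤ d → d ≤ 1 →
      0 ≤ a' → a' ≤ b' → b' ≤ 1 → 0 ≤ c' → c' ≤ d' → d' ≤ 1 →
      phase ∩ bakerMap r p ⁻¹' rect n a b c d = rect m a' b' c' d' →
      modeCharge k F m a' b' c' d' = chi r p k * modeCharge k F n a b c d

/-- `F` is a continuous solution on `[0,1]`, with `F 1 = 1`, of the functional equation of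
de Rham type
`F(y) = ∑_{i < j} (p_i / χ_k) e^{-iki} + (p_j / χ_k) e^{-ikj} F((y - yLeft j) / p (-j))`
for `yLeft j ≤ y < yLeft j + p (-j)` and all hops `j`. -/
def IsDeRhamSolution (r : ℕ) (p : ℤ → ℝ) (k : ℝ) (F : ℝ → ℂ) : Prop :=
  ContinuousOn F (Icc 0 1) ∧ F 1 = 1 ∧
    ∀ j ∈ hops r, ∀ y : ℝ, yLeft r p j ≤ y → y < yLeft r p j + p (-j) →
      F y = ∑ i ∈ below r j, (p i : ℂ) / chi r p k * Complex.exp (-(Complex.I * k * i))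
        + (p j : ℂ) / chi r p k * Complex.exp (-(Complex.I * k * j))
          * F ((y - yLeft r p j) / p (-j))

/-- The image of `t ∈ [0,1]` in the cylinder interval of the word `ω₁ … ω_l` of hops:
`y(ω₁, …, ω_l) = yLeft ω₁ + p (-ω₁) y(ω₂, …, ω_l)`, with `y(∅) = t`. For `t = 0` this is the
point with finite `r`-adic expansion `ω₁ … ω_l`, for `t = 1` it is the next such point
`y(ω₁, …, ω_l + 1)` (or `1`, if there is none). -/
def wordPoint (r : ℕ) (p : ℤ → ℝ) {l : ℕ} (ω : Fin l → {j : ℤ // j ∈ hops r}) (t : ℝ) : ℝ :=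
  (List.ofFn ω).foldr (fun j s => yLeft r p j.1 + p (-j.1) * s) t

/-- `Γ_l^s(F) = ∑ |F(y(ω₁, …, ω_l + 1)) - F(y(ω₁, …, ω_l))|^s`, over all words of length `l`. -/
def cylinderSum (r : ℕ) (p : ℤ → ℝ) (F : ℝ → ℂ) (s : ℝ) (l : ℕ) : ℝ :=
  ∑ ω : Fin l → {j : ℤ // j ∈ hops r},
    ‖F (wordPoint r p ω 1) - F (wordPoint r p ω 0)‖ ^ s

/-- `d` is the critical exponent of the cylinder sums: `Γ_l^s → ∞` for `s < d` and
`Γ_l^s → 0` for `s > d`. -/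
def IsCylinderDimension (r : ℕ) (p : ℤ → ℝ) (F : ℝ → ℂ) (d : ℝ) : Prop :=
  (∀ s < d, Tendsto (cylinderSum r p F s) atTop atTop) ∧
    (∀ s > d, Tendsto (cylinderSum r p F s) atTop (𝓝 0))

/-- The diffusion coefficient. -/
def diffusion (r : ℕ) (p : ℤ → ℝ) : ℝ :=
  1 / 2 * ∑ j ∈ hops r, (j : ℝ) ^ 2 * p j - 1 / 2 * (∑ j ∈ hops r, (j : ℝ) * p j) ^ 2

/-- The mean positive Lyapunov exponent (the stretching factor along `x` is `1 / p j` on the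
vertical strip of hop `j`, which has width `p j`). -/
def lyapunov (r : ℕ) (p : ℤ → ℝ) : ℝ := ∑ j ∈ hops r, p j * Real.log (1 / p j)

end MultiBaker

end

/-! Put `c_j = (p_j / χ_k) e^{-ikj}`; these coefficients sum to 1. Invariance of the charge, tested
on the horizontal strip of hop `j`, says that the increments of `F` over the `j`-th cell (of height
`p_{-j}`) are `c_j` times its increments over `[0,1]`. A mode is therefore a curve from 0 to 1
composed of its images under the similarities `z ↦ ∑_{i<j} c_i + c_j z`, and so is a solution of the
de Rham equation. For small `k` the ratios `‖c_j‖ = p_j / |χ_k|` stay below a constant less than 1;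
contraction gives existence (`exists_isDeRhamCurve`) and uniqueness (`IsDeRhamCurve.eqOn`). The
cylinder sums equal `(∑ ‖c_j‖^s)^l`, so their critical exponent is the similarity dimension `d`, the
root of `∑ ‖c_j‖^d = 1`.

The natural covers give `dimH ≤ d` (`IsDeRhamCurve.dimH_le`). The converse needs separated pieces,
but the curve may spiral around the junctions of its pieces: a run of the first or last symbol turns
it by a power of one coefficient. The arguments of the `c_j` are `O(k)`, so a run of order `1/|k|`
symbols turns it only little. Codes are therefore restricted to blocks of length `M ~ 1/|k|` that
are not a power of an extreme symbol. The corresponding pieces are disjoint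
(`IsDeRhamCurve.cell_ne_cell`), and the mass distribution principle (`le_dimH_range_of_separated`)
applies to this subsystem. The discarded blocks have weight at most `2σ^M` with `σ < 1`, which
lowers the dimension by `O(σ^M) = O(k^4)` (`IsDeRhamCurve.le_dimH`). The two dimensions thus share
their expansion, and their equality is never needed.

Finally `|χ_k|²` is a mean of cosines of hop differences, whence `-log |χ_k| = 𝒟 k² + O(k^4)`, and
`∑ p_j^d = |χ_k|^d` linearized at `d = 1` gives `λ⁺ (d - 1) = -log |χ_k| + O(k^4)`
(`eventually_abs_exponent_sub_le`). -/

namespace MultiBaker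

/-! ### Partial sums of ordered weights and the cells they cut out. -/

section LowerSum

variable {ι : Type*} [Fintype ι] [LinearOrder ι] {E : Type*} [AddCommMonoid E]

/-- The sum of the values at the indices smaller than `j`. -/
def lowerSum (a : ι → E) (j : ι) : E := ∑ i with i < j, a i

theorem lowerSum_of_isMin (a : ι → E) {j : ι} (hj : IsMin j) : lowerSum a j = 0 := by
  rw [lowerSum, Finset.filter_eq_empty_iff.mpr, Finset.sum_empty]
  exact fun i _ => hj.not_lt

theorem lowerSum_of_covBy (a : ι → E) {m j : ι} (h : m ⋖ j) :
    lowerSum a j = lowerSum a m + a m := by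
  have : (Finset.univ.filter (· < j)) = insert m (Finset.univ.filter (· < m)) := by
    ext i
    simp only [Finset.mem_filter, Finset.mem_univ, true_and, Finset.mem_insert]
    rw [← le_iff_eq_or_lt]
    exact ⟨fun hi => not_lt.mp fun hm => h.2 hm hi, fun hi => hi.trans_lt h.1⟩
  rw [lowerSum, this, Finset.sum_insert (by simp), add_comm, lowerSum]

theorem lowerSum_add_of_isMax (a : ι → E) {j : ι} (hj : IsMax j) :
    lowerSum a j + a j = ∑ i, a i := by
  have : (Finset.univ : Finset ι) = insert j (Finset.univ.filter (· < j)) := by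
    ext i
    simp only [Finset.mem_univ, Finset.mem_insert, Finset.mem_filter, true_and, true_iff]
    exact (not_lt.mp hj.not_lt : i ≤ j).eq_or_lt
  rw [this, Finset.sum_insert (by simp), add_comm, lowerSum]

theorem lowerSum_add_sum_between (a : ι → E) {i j : ι} (h : i < j) :
    lowerSum a j = lowerSum a i + a i + ∑ m with i < m ∧ m < j, a m := by
  have h1 : (Finset.univ.filter (· < j)) = (insert i (Finset.univ.filter (· < i))) ∪
      Finset.univ.filter (fun m => i < m ∧ m < j) := by
    ext m
    simp only [Finset.mem_filter, Finset.mem_univ, true_and, Finset.mem_insert, Finset.mem_union]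
    rw [← le_iff_eq_or_lt]
    constructor
    · intro hm
      rcases le_or_gt m i with h' | h'
      · exact Or.inl h'
      · exact Or.inr ⟨h', hm⟩
    · rintro (h' | h')
      · exact h'.trans_lt h
      · exact h'.2
  rw [lowerSum, h1, Finset.sum_union, Finset.sum_insert (by simp), add_comm (a i), lowerSum]
  rw [Finset.disjoint_left]
  intro m hm hm'
  simp only [Finset.mem_filter, Finset.mem_univ, true_and, Finset.mem_insert] at hm hm'
  rcases hm with rfl | hm
  · exact lt_irrefl _ hm'.1
  · exact lt_asymm hm hm'.1

theorem lowerSum_nonneg {a : ι → ℝ} (ha : ∀ i, 0 ≤ a i) (j : ι) : 0 ≤ lowerSum a j :=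
  Finset.sum_nonneg fun i _ => ha i

theorem lowerSum_add_le {a : ι → ℝ} (ha : ∀ i, 0 ≤ a i) {i j : ι} (h : i < j) :
    lowerSum a i + a i ≤ lowerSum a j := by
  rw [lowerSum_add_sum_between a h]
  exact le_add_of_nonneg_right (Finset.sum_nonneg fun i _ => ha i)

theorem lowerSum_add_le_sum {a : ι → ℝ} (ha : ∀ i, 0 ≤ a i) (j : ι) :
    lowerSum a j + a j ≤ ∑ i, a i := by
  rw [lowerSum, add_comm, ← Finset.sum_insert (by simp : j ∉ Finset.univ.filter (· < j))]
  exact Finset.sum_le_sum_of_subset_of_nonneg (Finset.subset_univ _) fun i _ _ => ha i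

/-- The half-open cells `[lowerSum a j, lowerSum a j + a j)` cover `[0, ∑ a)`. -/
theorem exists_mem_cell {a : ι → ℝ} {y : ℝ} (h0 : 0 ≤ y) (h1 : y < ∑ i, a i) :
    ∃ j, lowerSum a j ≤ y ∧ y < lowerSum a j + a j := by
  by_contra! hcon
  -- A point in no cell is pushed past the right end of each cell in turn, hence past the total sum.
  have hle : ∀ j, lowerSum a j + a j ≤ y := by
    intro j
    induction j using WellFoundedLT.induction with
    | ind j ih =>
      refine hcon j ?_
      by_cases hj : IsMin j
      · rwa [lowerSum_of_isMin a hj]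
      · obtain ⟨m, hm⟩ := exists_covBy_of_wellFoundedGT hj
        rw [lowerSum_of_covBy a hm]
        exact ih m hm.1
  rcases isEmpty_or_nonempty ι with hι | hι
  · simp at h1; linarith
  · have hmax : IsMax (Finset.univ.max' (Finset.univ_nonempty (α := ι))) :=
      fun i _ => Finset.le_max' _ i (Finset.mem_univ i)
    have := hle (Finset.univ.max' Finset.univ_nonempty)
    rw [lowerSum_add_of_isMax a hmax] at this
    linarith

theorem eq_of_mem_cell {a : ι → ℝ} (ha : ∀ i, 0 ≤ a i) {i j : ι} {y : ℝ}
    (hi : lowerSum a i ≤ y) (hi' : y < lowerSum a i + a i)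
    (hj : lowerSum a j ≤ y) (hj' : y < lowerSum a j + a j) : i = j := by
  rcases lt_trichotomy i j with h | h | h
  · linarith [lowerSum_add_le ha h]
  · exact h
  · linarith [lowerSum_add_le ha h]

end LowerSum

/-- A bounded function that is dominated by an affine contraction of its own values is bounded
by the fixed point of the contraction. -/
theorem le_div_of_forall_exists_le {α : Type*} {s : Set α} {g : α → ℝ} {B e ρ : ℝ}
    (hρ0 : 0 ≤ ρ) (hρ : ρ < 1) (hB : ∀ x ∈ s, g x ≤ B)
    (h : ∀ x ∈ s, ∃ y ∈ s, g x ≤ e + ρ * g y) : ∀ x ∈ s, g x ≤ e / (1 - ρ) := by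
  intro x hx
  have hbdd : BddAbove (g '' s) := ⟨B, by rintro _ ⟨y, hy, rfl⟩; exact hB y hy⟩
  have hS : sSup (g '' s) ≤ e + ρ * sSup (g '' s) := by
    refine csSup_le ⟨_, mem_image_of_mem g hx⟩ ?_
    rintro _ ⟨y, hy, rfl⟩
    obtain ⟨z, hz, hyz⟩ := h y hy
    have := le_csSup hbdd (mem_image_of_mem g hz)
    nlinarith
  have h1 := le_csSup hbdd (mem_image_of_mem g hx)
  rw [le_div_iff₀ (by linarith)]
  nlinarith

/-- `F` is a continuous curve on `[0,1]` from `0` to `1`, composed of the copies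
`lowerSum c j + c j * F` over the cells of the weights `h`. -/
structure IsDeRhamCurve {ι : Type*} [Fintype ι] [LinearOrder ι] (h : ι → ℝ) (c : ι → ℂ)
    (F : ℝ → ℂ) : Prop where
  continuousOn : ContinuousOn F (Icc 0 1)
  zero : F 0 = 0
  one : F 1 = 1
  map_cell : ∀ j, ∀ t ∈ Icc (0 : ℝ) 1, F (lowerSum h j + h j * t) = lowerSum c j + c j * F t

/-! ### Existence, uniqueness and self-similarity of the de Rham curve. -/

section Curve

variable {ι : Type*} [Fintype ι] [LinearOrder ι] {h : ι → ℝ} {c : ι → ℂ}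

theorem cell_mem_Icc (h0 : ∀ j, 0 < h j) (h1 : ∑ j, h j = 1) (j : ι) {t : ℝ}
    (ht : t ∈ Icc (0 : ℝ) 1) : lowerSum h j + h j * t ∈ Icc (0 : ℝ) 1 := by
  have hA := lowerSum_nonneg (fun i => (h0 i).le) j
  have hB := lowerSum_add_le_sum (fun i => (h0 i).le) j
  have := h0 j
  constructor
  · have := mul_nonneg (h0 j).le ht.1
    linarith
  · nlinarith [ht.2]

/-- Every point of `[0,1]` lies in a closed cell. -/
theorem exists_cell_eq (h0 : ∀ j, 0 < h j) (h1 : ∑ j, h j = 1) {y : ℝ} (hy : y ∈ Icc (0 : ℝ) 1) :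
    ∃ j, ∃ t ∈ Icc (0 : ℝ) 1, y = lowerSum h j + h j * t ∧ (y < 1 → t < 1) := by
  rcases hy.2.lt_or_eq with hlt | rfl
  · obtain ⟨j, hj, hj'⟩ := exists_mem_cell hy.1 (h1 ▸ hlt)
    refine ⟨j, (y - lowerSum h j) / h j, ⟨div_nonneg (by linarith) (h0 j).le, ?_⟩, ?_, ?_⟩
    · rw [div_le_one (h0 j)]; linarith
    · field_simp [(h0 j).ne']; ring
    · intro _; rw [div_lt_one (h0 j)]; linarith
  · have hι : Nonempty ι := by
      by_contra hne
      rw [not_nonempty_iff] at hne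
      simp at h1
    have hmax : IsMax (Finset.univ.max' (Finset.univ_nonempty (α := ι))) :=
      fun i _ => Finset.le_max' _ i (Finset.mem_univ i)
    refine ⟨Finset.univ.max' Finset.univ_nonempty, 1, by simp, ?_, fun hh => absurd hh (lt_irrefl _)⟩
    rw [mul_one, lowerSum_add_of_isMax h hmax, h1]

/-- The value at a point of a closed cell of the de Rham operator. -/
theorem sum_mul_comp_cell (h0 : ∀ j, 0 < h j) {G : ℝ → ℂ} (hG0 : ∀ y ≤ 0, G y = 0)
    (hG1 : ∀ y, 1 ≤ y → G y = 1) (j : ι) {t : ℝ} (ht : t ∈ Icc (0 : ℝ) 1) :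
    ∑ i, c i * G ((lowerSum h j + h j * t - lowerSum h i) / h i) = lowerSum c j + c j * G t := by
  -- With `G` equal to 0 left of the unit interval and 1 right of it, cells before `j` contribute
  -- their full weight and cells after `j` nothing.
  have key : ∀ i, c i * G ((lowerSum h j + h j * t - lowerSum h i) / h i) =
      (if i < j then c i else 0) + if i = j then c i * G t else 0 := by
    intro i
    rcases lt_trichotomy i j with hij | rfl | hij
    · have := lowerSum_add_le (fun i => (h0 i).le) hij
      rw [if_pos hij, if_neg hij.ne, hG1, mul_one, add_zero]
      rw [le_div_iff₀ (h0 i)]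
      nlinarith [mul_nonneg (h0 j).le ht.1]
    · rw [if_neg (lt_irrefl _), if_pos rfl, zero_add]
      congr 2
      field_simp [(h0 i).ne']; ring
    · have := lowerSum_add_le (fun i => (h0 i).le) hij
      rw [if_neg hij.not_gt, if_neg hij.ne', hG0, mul_zero, add_zero]
      refine div_nonpos_of_nonpos_of_nonneg ?_ (h0 i).le
      nlinarith [ht.2, h0 j]
  rw [Finset.sum_congr rfl fun i _ => key i, Finset.sum_add_distrib, ← Finset.sum_filter]
  simp [lowerSum]

/-- Banach's fixed point theorem for `G ↦ ∑ c_j G((y - lowerSum h j) / h j)`. Working on the whole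
line, with functions that are 0 on the left and 1 on the right, makes continuity at the junctions
automatic. The condition `∑ c = 1` preserves the value 1, and at each point only one cell can see a
difference of two such functions, so the contraction factor is the largest `‖c j‖` and not their
sum. -/
theorem exists_isDeRhamCurve (h0 : ∀ j, 0 < h j) (h1 : ∑ j, h j = 1) (hc : ∑ j, c j = 1)
    {ρ : ℝ} (hρ : ρ < 1) (hcρ : ∀ j, ‖c j‖ ≤ ρ) : ∃ F, IsDeRhamCurve h c F := by
  have hι : Nonempty ι := by
    by_contra hne
    rw [not_nonempty_iff] at hne
    simp at h1
  have hρ0 : 0 ≤ ρ := (norm_nonneg _).trans (hcρ (Classical.arbitrary ι))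
  have hA := fun j => lowerSum_nonneg (fun i => (h0 i).le) j
  have hB := fun j => lowerSum_add_le_sum (fun i => (h0 i).le) j
  let T : BoundedContinuousFunction ℝ ℂ → BoundedContinuousFunction ℝ ℂ := fun G =>
    ∑ j, c j • G.compContinuous ⟨fun y => (y - lowerSum h j) / h j, by fun_prop⟩
  have hT : ∀ G y, T G y = ∑ j, c j * G ((y - lowerSum h j) / h j) := by
    intro G y
    simp [T, BoundedContinuousFunction.coe_sum]
  let S : Set (BoundedContinuousFunction ℝ ℂ) :=
    {G | (∀ y ≤ 0, G y = 0) ∧ ∀ y, 1 ≤ y → G y = 1}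
  have hSclosed : IsClosed S := by
    have : S = (⋂ y ∈ Iic (0 : ℝ), {G : BoundedContinuousFunction ℝ ℂ | G y = 0}) ∩
        ⋂ y ∈ Ici (1 : ℝ), {G : BoundedContinuousFunction ℝ ℂ | G y = 1} := by
      ext G; simp [S]
    rw [this]
    exact (isClosed_biInter fun y _ => isClosed_eq
      (continuous_eval_const y) continuous_const).inter
      (isClosed_biInter fun y _ => isClosed_eq
        (continuous_eval_const y) continuous_const)
  have hmaps : MapsTo T S S := by
    intro G hG
    refine ⟨fun y hy => ?_, fun y hy => ?_⟩
    · rw [hT]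
      refine Finset.sum_eq_zero fun j _ => ?_
      rw [hG.1, mul_zero]
      exact div_nonpos_of_nonpos_of_nonneg (by linarith [hA j]) (h0 j).le
    · rw [hT, ← hc]
      refine Finset.sum_congr rfl fun j _ => ?_
      rw [hG.2, mul_one]
      rw [le_div_iff₀ (h0 j)]
      linarith [hB j]
  have hlip : ∀ G ∈ S, ∀ G' ∈ S, dist (T G) (T G') ≤ ρ * dist G G' := by
    intro G hG G' hG'
    rw [BoundedContinuousFunction.dist_le (by positivity)]
    intro y
    by_cases hy : y ∈ Icc (0 : ℝ) 1
    · obtain ⟨j, t, ht, rfl, -⟩ := exists_cell_eq h0 h1 hy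
      rw [hT, hT, sum_mul_comp_cell h0 hG.1 hG.2 j ht, sum_mul_comp_cell h0 hG'.1 hG'.2 j ht,
        dist_add_left, dist_eq_norm, ← mul_sub, norm_mul, ← dist_eq_norm]
      exact mul_le_mul (hcρ j) (BoundedContinuousFunction.dist_coe_le_dist t) dist_nonneg hρ0
    · have : T G y = T G' y := by
        rw [mem_Icc, not_and_or, not_le, not_le] at hy
        rcases hy with hy | hy
        · rw [(hmaps hG).1 y hy.le, (hmaps hG').1 y hy.le]
        · rw [(hmaps hG).2 y hy.le, (hmaps hG').2 y hy.le]
      rw [this, dist_self]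
      positivity
  let clamp : BoundedContinuousFunction ℝ ℂ :=
    BoundedContinuousFunction.ofNormedAddCommGroup
      (fun y : ℝ => ((max 0 (min 1 y) : ℝ) : ℂ)) (by fun_prop) 1 (by
        intro y
        rw [Complex.norm_real, Real.norm_eq_abs, abs_of_nonneg (le_max_left _ _)]
        exact max_le zero_le_one (min_le_left _ _))
  have hclamp : clamp ∈ S := by
    refine ⟨fun y hy => ?_, fun y hy => ?_⟩
    · simp only [clamp, BoundedContinuousFunction.coe_ofNormedAddCommGroup]
      rw [min_eq_right (by linarith), max_eq_left hy, Complex.ofReal_zero]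
    · simp only [clamp, BoundedContinuousFunction.coe_ofNormedAddCommGroup]
      rw [min_eq_left hy, max_eq_right zero_le_one, Complex.ofReal_one]
  have hcontr : ContractingWith (⟨ρ, hρ0⟩ : NNReal) (hmaps.restrict T S S) := by
    refine ⟨by exact_mod_cast hρ, LipschitzWith.of_dist_le_mul ?_⟩
    intro G G'
    exact hlip G G.2 G' G'.2
  obtain ⟨F, hFS, hF, -⟩ := hcontr.exists_fixedPoint' hSclosed.isComplete hmaps hclamp
    (edist_ne_top _ _)
  refine ⟨F, F.continuous.continuousOn, hFS.1 0 le_rfl, hFS.2 1 le_rfl, fun j t ht => ?_⟩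
  rw [← sum_mul_comp_cell h0 hFS.1 hFS.2 j ht, ← hT, hF.eq]

variable {F : ℝ → ℂ}

/-- A bounded function that satisfies the functional equation on the half-open cells is the
de Rham curve. -/
theorem IsDeRhamCurve.eqOn (hF : IsDeRhamCurve h c F) (h0 : ∀ j, 0 < h j) (h1 : ∑ j, h j = 1)
    {ρ : ℝ} (hρ : ρ < 1) (hρ0 : 0 ≤ ρ) (hcρ : ∀ j, ‖c j‖ ≤ ρ) {G : ℝ → ℂ}
    (hG : ContinuousOn G (Icc 0 1)) (hG1 : G 1 = 1)
    (hGc : ∀ j, ∀ t ∈ Ico (0 : ℝ) 1, G (lowerSum h j + h j * t) = lowerSum c j + c j * G t) :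
    EqOn G F (Icc 0 1) := by
  obtain ⟨B, hB⟩ := isCompact_Icc.exists_bound_of_continuousOn (hG.sub hF.continuousOn)
  have := le_div_of_forall_exists_le (s := Icc (0 : ℝ) 1) (g := fun y => ‖G y - F y‖) (e := 0)
    hρ0 hρ hB (by
      intro y hy
      rcases hy.2.lt_or_eq with hlt | rfl
      · obtain ⟨j, t, ht, rfl, htlt⟩ := exists_cell_eq h0 h1 hy
        refine ⟨t, ht, ?_⟩
        rw [hGc j t ⟨ht.1, htlt hlt⟩, hF.map_cell j t ht, add_sub_add_left_eq_sub, ← mul_sub,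
          norm_mul, zero_add]
        exact mul_le_mul_of_nonneg_right (hcρ j) (norm_nonneg _)
      -- The half-open cells do not reach the point 1; there the normalization makes the difference
      -- vanish.
      · exact ⟨1, hy, by simp [hG1, hF.one]⟩)
  intro y hy
  have h2 := this y hy
  rw [zero_div] at h2
  exact sub_eq_zero.mp (norm_le_zero_iff.mp h2)

/-- A continuous function whose increments on the cells are scaled copies of its increments on
`[0,1]` is the de Rham curve. -/
theorem IsDeRhamCurve.of_increments {G : ℝ → ℂ} (hG : ContinuousOn G (Icc 0 1))
    (hG0 : G 0 = 0) (hG1 : G 1 = 1)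
    (hGc : ∀ j, ∀ t ∈ Icc (0 : ℝ) 1, G (lowerSum h j + h j * t) - G (lowerSum h j) = c j * G t) :
    IsDeRhamCurve h c G := by
  -- The increment over a whole cell is `c j`, so the values at the left ends accumulate from `G 0 =
  -- 0`.
  have hlow : ∀ j, G (lowerSum h j) = lowerSum c j := by
    intro j
    induction j using WellFoundedLT.induction with
    | ind j ih =>
      by_cases hj : IsMin j
      · rw [lowerSum_of_isMin h hj, lowerSum_of_isMin c hj, hG0]
      · obtain ⟨m, hm⟩ := exists_covBy_of_wellFoundedGT hj
        have := hGc m 1 (by simp)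
        rw [mul_one, hG1, mul_one, ih m hm.1] at this
        rw [lowerSum_of_covBy h hm, lowerSum_of_covBy c hm, ← this]
        ring
  refine ⟨hG, hG0, hG1, fun j t ht => ?_⟩
  rw [← hlow, ← hGc j t ht]
  ring

/-- The point of the cell of a word, with relative position `t`. -/
def wordMap (h : ι → ℝ) (w : List ι) (t : ℝ) : ℝ :=
  w.foldr (fun j s => lowerSum h j + h j * s) t

/-- The similarity that maps the curve to the part of the curve over the cell of a word. -/
def curveMap (c : ι → ℂ) (w : List ι) (z : ℂ) : ℂ :=
  w.foldr (fun j s => lowerSum c j + c j * s) z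

/-- The contraction ratio of the similarity of a word. -/
noncomputable def wordRatio (c : ι → ℂ) (w : List ι) : ℝ := (w.map fun j => ‖c j‖).prod

@[simp] theorem wordMap_cons (j : ι) (w : List ι) (t : ℝ) :
    wordMap h (j :: w) t = lowerSum h j + h j * wordMap h w t := rfl

@[simp] theorem curveMap_cons (j : ι) (w : List ι) (z : ℂ) :
    curveMap c (j :: w) z = lowerSum c j + c j * curveMap c w z := rfl

theorem curveMap_append (v w : List ι) (z : ℂ) :
    curveMap c (v ++ w) z = curveMap c v (curveMap c w z) := List.foldr_append

theorem wordMap_mem_Icc (h0 : ∀ j, 0 < h j) (h1 : ∑ j, h j = 1) (w : List ι) {t : ℝ}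
    (ht : t ∈ Icc (0 : ℝ) 1) : wordMap h w t ∈ Icc (0 : ℝ) 1 := by
  induction w with
  | nil => exact ht
  | cons j w ih => exact cell_mem_Icc h0 h1 j ih

theorem IsDeRhamCurve.wordMap (hF : IsDeRhamCurve h c F) (h0 : ∀ j, 0 < h j)
    (h1 : ∑ j, h j = 1) (w : List ι) {t : ℝ} (ht : t ∈ Icc (0 : ℝ) 1) :
    F (wordMap h w t) = curveMap c w (F t) := by
  induction w with
  | nil => rfl
  | cons j w ih => rw [wordMap_cons, hF.map_cell j _ (wordMap_mem_Icc h0 h1 w ht), ih]; rfl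

theorem dist_curveMap (w : List ι) (z z' : ℂ) :
    dist (curveMap c w z) (curveMap c w z') = wordRatio c w * dist z z' := by
  induction w with
  | nil => simp [curveMap, wordRatio]
  | cons j w ih =>
    rw [curveMap_cons, curveMap_cons, dist_add_left, dist_eq_norm, ← mul_sub, norm_mul,
      ← dist_eq_norm, ih, ← mul_assoc]
    simp [wordRatio]

theorem dist_wordMap_le (h0 : ∀ j, 0 < h j) {θ : ℝ} (hθ : θ ≤ 1) (hh : ∀ j, h j ≤ θ)
    (w : List ι) (hw : w ≠ []) (t t' : ℝ) :
    dist (MultiBaker.wordMap h w t) (MultiBaker.wordMap h w t') ≤ θ * dist t t' := by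
  induction w with
  | nil => exact absurd rfl hw
  | cons j w ih =>
    rw [wordMap_cons, wordMap_cons, dist_add_left, Real.dist_eq, ← mul_sub, abs_mul,
      abs_of_pos (h0 j), ← Real.dist_eq]
    refine mul_le_mul (hh j) ?_ dist_nonneg ((h0 j).le.trans (hh j))
    by_cases hw' : w = []
    · subst hw'; exact le_rfl
    · exact (ih hw').trans (mul_le_of_le_one_left dist_nonneg hθ)

omit [Fintype ι] [LinearOrder ι] in
theorem wordRatio_ofFn {n : ℕ} (w : Fin n → ι) :
    wordRatio c (List.ofFn w) = ∏ i, ‖c (w i)‖ := by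
  rw [wordRatio, List.map_ofFn, List.prod_ofFn]; rfl

omit [Fintype ι] [LinearOrder ι] in
theorem wordRatio_ofFn_le {ρ : ℝ} (hcρ : ∀ j, ‖c j‖ ≤ ρ) {n : ℕ} (w : Fin n → ι) :
    wordRatio c (List.ofFn w) ≤ ρ ^ n := by
  rw [wordRatio_ofFn]
  refine (Finset.prod_le_prod (fun _ _ => norm_nonneg _) fun i _ => hcρ (w i)).trans_eq ?_
  simp

-- Ratios multiply along a word, so the sum over words factors. This one identity serves the
-- covering bound, the weight of the mixed words and the cylinder sums.
omit [LinearOrder ι] in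
theorem sum_wordRatio_rpow (c : ι → ℂ) (s : ℝ) (n : ℕ) :
    ∑ w : Fin n → ι, wordRatio c (List.ofFn w) ^ s = (∑ j, ‖c j‖ ^ s) ^ n := by
  simp_rw [wordRatio_ofFn]
  rw [← Fin.prod_const, Finset.prod_univ_sum, Fintype.piFinset_univ]
  refine Finset.sum_congr rfl fun w _ => ?_
  rw [Real.finsetProd_rpow _ _ fun i _ => norm_nonneg _]

theorem exists_wordMap_eq (h0 : ∀ j, 0 < h j) (h1 : ∑ j, h j = 1) (n : ℕ) {y : ℝ}
    (hy : y ∈ Icc (0 : ℝ) 1) :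
    ∃ w : Fin n → ι, ∃ t ∈ Icc (0 : ℝ) 1, MultiBaker.wordMap h (List.ofFn w) t = y := by
  induction n generalizing y with
  | zero => exact ⟨Fin.elim0, y, hy, by simp [MultiBaker.wordMap]⟩
  | succ n ih =>
    obtain ⟨j, t, ht, rfl, -⟩ := exists_cell_eq h0 h1 hy
    obtain ⟨w, t', ht', rfl⟩ := ih ht
    exact ⟨Fin.cons j w, t', ht', by simp [List.ofFn_succ]⟩

end Curve

/-! ### Upper bound for the Hausdorff dimension, and the mass distribution principle. -/

section Dimension

open MeasureTheory Measure

/-- The pieces over the words of length `n` cover the curve, their diameters tend to 0, and the sum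
of their `d`-th powers is at most `diam ^ d` for all `n`. Hence the `d`-dimensional measure is
finite; overlaps do no harm. -/
theorem IsDeRhamCurve.dimH_le {ι : Type*} [Fintype ι] [LinearOrder ι] {h : ι → ℝ} {c : ι → ℂ}
    {F : ℝ → ℂ} (hF : IsDeRhamCurve h c F) (h0 : ∀ j, 0 < h j) (h1 : ∑ j, h j = 1)
    {ρ : ℝ} (hρ : ρ < 1) (hρ0 : 0 ≤ ρ) (hcρ : ∀ j, ‖c j‖ ≤ ρ) {d : ℝ} (hd : 0 ≤ d)
    (hsum : ∑ j, ‖c j‖ ^ d ≤ 1) : dimH (F '' Icc 0 1) ≤ ENNReal.ofReal d := by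
  set X := F '' Icc 0 1 with hX
  have hXc : IsCompact X := isCompact_Icc.image_of_continuousOn hF.continuousOn
  set D := Metric.ediam X with hD
  have hDtop : D ≠ ⊤ := hXc.isBounded.ediam_ne_top
  have hratio0 : ∀ w : List ι, 0 ≤ wordRatio c w := fun w =>
    List.prod_nonneg (by simp only [List.mem_map]; rintro _ ⟨j, -, rfl⟩; exact norm_nonneg _)
  have hdiam : ∀ w : List ι,
      Metric.ediam (curveMap c w '' X) ≤ ENNReal.ofReal (wordRatio c w) * D := by
    intro w
    refine LipschitzWith.ediam_image_le (K := (wordRatio c w).toNNReal) ?_ X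
    refine LipschitzWith.of_dist_le_mul fun z z' => ?_
    rw [dist_curveMap, Real.coe_toNNReal _ (hratio0 w)]
  have hle : μH[d] X ≤ liminf (fun n : ℕ => ∑ w : Fin n → ι,
      Metric.ediam (curveMap c (List.ofFn w) '' X) ^ d) atTop := by
    refine Measure.hausdorffMeasure_le_liminf_sum d X (fun n => ENNReal.ofReal (ρ ^ n) * D) ?_
      (fun n (w : Fin n → ι) => curveMap c (List.ofFn w) '' X)
      (Eventually.of_forall fun n w => ?_) (Eventually.of_forall fun n => ?_)
    · have := ENNReal.Tendsto.mul_const (b := D) (ENNReal.tendsto_ofReal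
        (tendsto_pow_atTop_nhds_zero_of_lt_one hρ0 hρ)) (Or.inr hDtop)
      simpa using this
    · refine (hdiam _).trans ?_
      gcongr
      exact wordRatio_ofFn_le hcρ w
    · rintro _ ⟨y, hy, rfl⟩
      obtain ⟨w, t, ht, rfl⟩ := exists_wordMap_eq h0 h1 n hy
      rw [hF.wordMap h0 h1 _ ht]
      exact mem_iUnion.mpr ⟨w, mem_image_of_mem _ (mem_image_of_mem _ ht)⟩
  have hbound : ∀ n : ℕ, ∑ w : Fin n → ι, Metric.ediam (curveMap c (List.ofFn w) '' X) ^ d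
      ≤ D ^ d := by
    intro n
    calc ∑ w : Fin n → ι, Metric.ediam (curveMap c (List.ofFn w) '' X) ^ d
        ≤ ∑ w : Fin n → ι, ENNReal.ofReal (wordRatio c (List.ofFn w) ^ d) * D ^ d := by
          refine Finset.sum_le_sum fun w _ => ?_
          rw [← ENNReal.ofReal_rpow_of_nonneg (hratio0 _) hd, ← ENNReal.mul_rpow_of_nonneg _ _ hd]
          exact ENNReal.rpow_le_rpow (hdiam _) hd
      _ = ENNReal.ofReal ((∑ j, ‖c j‖ ^ d) ^ n) * D ^ d := by
          rw [← sum_wordRatio_rpow, ENNReal.ofReal_sum_of_nonneg, Finset.sum_mul]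
          exact fun w _ => Real.rpow_nonneg (hratio0 _) _
      _ ≤ 1 * D ^ d := by
          gcongr
          rw [← ENNReal.ofReal_one]
          refine ENNReal.ofReal_le_ofReal (pow_le_one₀ ?_ hsum)
          exact Finset.sum_nonneg fun j _ => Real.rpow_nonneg (norm_nonneg _) _
      _ = D ^ d := one_mul _
  have hfin : μH[d] X ≠ ⊤ := by
    refine ne_top_of_le_ne_top (ENNReal.rpow_ne_top_of_nonneg hd hDtop) (hle.trans ?_)
    exact liminf_le_of_le (by isBoundedDefault) fun b hb =>
      let ⟨n, hn⟩ := hb.exists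
      hn.trans (hbound n)
  have := dimH_le_of_hausdorffMeasure_ne_top (s := X) (d := d.toNNReal)
    (by rwa [Real.coe_toNNReal d hd])
  exact this

/-- Mass distribution principle for a coded set: if points with codes that differ for the first
time at `n` are separated by a multiple of the product of the first `n` ratios, and `q` is a
probability vector with `q ≤ ratio ^ s`, then the coded set has dimension at least `s`. -/
theorem le_dimH_range_of_separated {W : Type*} [Fintype W] [TopologicalSpace W]
    [DiscreteTopology W] {X : Type*} [MetricSpace X] {π : (ℕ → W) → X} (hπ : Continuous π)
    {q ratio : W → ℝ} {s ε : ℝ} (hs : 0 ≤ s) (hε : 0 < ε) (hq0 : ∀ w, 0 ≤ q w)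
    (hq1 : ∀ w, q w < 1) (hsum : ∑ w, q w = 1) (hr : ∀ w, 0 < ratio w)
    (hqr : ∀ w, q w ≤ ratio w ^ s)
    (hsep : ∀ ω ω' n, (∀ i < n, ω i = ω' i) → ω n ≠ ω' n →
      ε * ∏ i ∈ Finset.range n, ratio (ω i) ≤ dist (π ω) (π ω')) :
    ENNReal.ofReal s ≤ dimH (range π) := by
  classical
  let : MeasurableSpace X := borel X
  have : BorelSpace X := ⟨rfl⟩
  let : MeasurableSpace W := ⊤
  have : BorelSpace W := ⟨borel_eq_top_of_discrete.symm⟩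
  have hW : Nonempty W := by
    by_contra hne
    rw [not_nonempty_iff] at hne
    simp at hsum
  let P : Measure W := ∑ w, ENNReal.ofReal (q w) • dirac w
  have hPs : ∀ w, P {w} = ENNReal.ofReal (q w) := by
    intro w
    simp [P, Measure.finsetSum_apply, Set.indicator_apply]
  have : IsProbabilityMeasure P := ⟨by
    simp only [P, Measure.finsetSum_apply, Measure.smul_apply, dirac_apply_of_mem (mem_univ _),
      smul_eq_mul, mul_one]
    rw [← ENNReal.ofReal_sum_of_nonneg fun w _ => hq0 w, hsum, ENNReal.ofReal_one]⟩
  let ν : Measure (ℕ → W) := infinitePi fun _ => P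
  have hcyl : ∀ (E : Set (ℕ → W)) (ω : ℕ → W) (n : ℕ), (∀ η ∈ E, ∀ i < n, η i = ω i) →
      ν E ≤ ENNReal.ofReal (∏ i ∈ Finset.range n, q (ω i)) := by
    intro E ω n hE
    calc ν E ≤ ν (Set.pi (Finset.range n) fun i => {ω i}) := by
          refine measure_mono fun η hη i hi => ?_
          exact hE η hη i (Finset.mem_range.mp hi)
      _ = ∏ i ∈ Finset.range n, P {ω i} := infinitePi_pi _ fun i _ => MeasurableSet.of_discrete
      _ = _ := by
          simp_rw [hPs]
          rw [ENNReal.ofReal_prod_of_nonneg fun i _ => hq0 _]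
  have hball : ∀ A : Set X, Metric.ediam A ≠ ⊤ →
      ν (π ⁻¹' A) ≤ ENNReal.ofReal ε⁻¹ ^ s * Metric.ediam A ^ s := by
    intro A hA
    -- A single code has mass zero since the largest `q` is below 1. Otherwise let `n` be the first
    -- index at which two codes of `A` differ: `A` is then in one cylinder of length `n`, and
    -- separation bounds its diameter below by the ratio of that cylinder.
    by_cases hsub : (π ⁻¹' A).Subsingleton
    · have hzero : ν (π ⁻¹' A) = 0 := by
        rcases hsub.eq_empty_or_singleton with he | ⟨ω, hω⟩
        · rw [he, measure_empty]
        · obtain ⟨w₀, hw₀⟩ := Finite.exists_max q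
          have hlim := ENNReal.tendsto_ofReal
            (tendsto_pow_atTop_nhds_zero_of_lt_one (hq0 w₀) (hq1 w₀))
          rw [ENNReal.ofReal_zero] at hlim
          refine le_antisymm (ge_of_tendsto' hlim fun n => ?_) bot_le
          refine (hcyl _ ω n ?_).trans (ENNReal.ofReal_le_ofReal ?_)
          · intro η hη i _
            rw [hω] at hη
            rw [mem_singleton_iff.mp hη]
          · refine (Finset.prod_le_prod (fun i _ => hq0 _) fun i _ => hw₀ (ω i)).trans_eq ?_
            simp
      rw [hzero]
      exact bot_le
    · have hex : ∃ n, ∃ ω ∈ π ⁻¹' A, ∃ ω' ∈ π ⁻¹' A, ω n ≠ ω' n := by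
        rw [Set.not_subsingleton_iff] at hsub
        obtain ⟨ω, hω, ω', hω', hne⟩ := hsub
        obtain ⟨n, hn⟩ := Function.ne_iff.mp hne
        exact ⟨n, ω, hω, ω', hω', hn⟩
      obtain ⟨ω, hω, ω', hω', hne⟩ := Nat.find_spec hex
      set n := Nat.find hex
      have hagree : ∀ η ∈ π ⁻¹' A, ∀ i < n, η i = ω i := by
        intro η hη i hi
        by_contra hcon
        exact Nat.find_min hex hi ⟨η, hη, ω, hω, hcon⟩
      have hd := hsep ω ω' n (fun i hi => (hagree ω' hω' i hi).symm) hne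
      have hpos : 0 ≤ ∏ i ∈ Finset.range n, ratio (ω i) :=
        Finset.prod_nonneg fun i _ => (hr _).le
      calc ν (π ⁻¹' A) ≤ ENNReal.ofReal (∏ i ∈ Finset.range n, q (ω i)) := hcyl _ ω n hagree
        _ ≤ ENNReal.ofReal ((ε⁻¹ * dist (π ω) (π ω')) ^ s) := by
            refine ENNReal.ofReal_le_ofReal ?_
            calc ∏ i ∈ Finset.range n, q (ω i) ≤ ∏ i ∈ Finset.range n, ratio (ω i) ^ s :=
                  Finset.prod_le_prod (fun i _ => hq0 _) fun i _ => hqr _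
              _ = (∏ i ∈ Finset.range n, ratio (ω i)) ^ s :=
                  Real.finsetProd_rpow _ _ (fun i _ => (hr _).le) s
              _ ≤ _ := by
                  refine Real.rpow_le_rpow hpos ?_ hs
                  rw [inv_mul_eq_div, le_div_iff₀ hε, mul_comm]
                  exact hd
        _ = (ENNReal.ofReal ε⁻¹ * edist (π ω) (π ω')) ^ s := by
            rw [edist_dist, ← ENNReal.ofReal_mul (by positivity),
              ENNReal.ofReal_rpow_of_nonneg (by positivity) hs]
        _ ≤ (ENNReal.ofReal ε⁻¹ * Metric.ediam A) ^ s := by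
            refine ENNReal.rpow_le_rpow ?_ hs
            gcongr
            exact Metric.edist_le_ediam_of_mem hω hω'
        _ = _ := ENNReal.mul_rpow_of_nonneg _ _ hs
  have hπm : Measurable π := hπ.measurable
  let K : ENNReal := ENNReal.ofReal ε ^ s
  have hK : K * ENNReal.ofReal ε⁻¹ ^ s = 1 := by
    rw [← ENNReal.mul_rpow_of_nonneg _ _ hs, ← ENNReal.ofReal_mul hε.le,
      mul_inv_cancel₀ hε.ne', ENNReal.ofReal_one, ENNReal.one_rpow]
  have hmass : K • ν.map π ≤ μH[s] := by
    refine Measure.le_hausdorffMeasure s _ 1 one_pos fun A hA => ?_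
    have hA' : Metric.ediam (closure A) ≠ ⊤ := by
      rw [Metric.ediam_closure]
      exact ne_top_of_le_ne_top ENNReal.one_ne_top hA
    -- The closure has the same diameter and, unlike an arbitrary set, is measurable.
    calc (K • ν.map π) A ≤ (K • ν.map π) (closure A) := measure_mono subset_closure
      _ = K * ν (π ⁻¹' closure A) := by
          rw [Measure.smul_apply, Measure.map_apply hπm isClosed_closure.measurableSet,
            smul_eq_mul]
      _ ≤ K * (ENNReal.ofReal ε⁻¹ ^ s * Metric.ediam (closure A) ^ s) := by
          gcongr
          exact hball _ hA'
      _ = Metric.ediam A ^ s := by rw [← mul_assoc, hK, one_mul, Metric.ediam_closure]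
  have hne : μH[s] (range π) ≠ 0 := by
    have h2 := hmass (range π)
    rw [Measure.smul_apply, Measure.map_apply hπm (isCompact_range hπ).measurableSet,
      preimage_range, measure_univ, smul_eq_mul, mul_one] at h2
    intro h3
    rw [h3, nonpos_iff_eq_zero] at h2
    rw [h2, zero_mul] at hK
    exact zero_ne_one hK
  exact le_dimH_of_hausdorffMeasure_ne_zero (d := s.toNNReal) (by rwa [Real.coe_toNNReal s hs])

/-- The coding map of a finite family of contractions. -/
theorem exists_coding {K W : Type*} [MetricSpace K] [CompactSpace K] [Nonempty K] [Finite W]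
    [TopologicalSpace W] [DiscreteTopology W] (g : W → K → K) {θ : ℝ} (hθ0 : 0 ≤ θ) (hθ : θ < 1)
    (hg : ∀ w x y, dist (g w x) (g w y) ≤ θ * dist x y) :
    ∃ Y : (ℕ → W) → K, Continuous Y ∧ ∀ ω, Y ω = g (ω 0) (Y fun n => ω (n + 1)) := by
  have hgc : Continuous fun a : W × K => g a.1 a.2 := by
    rw [continuous_prod_of_discrete_left]
    exact fun w => (LipschitzWith.of_dist_le_mul (K := ⟨θ, hθ0⟩) (hg w)).continuous
  have hshift : Continuous fun (ω : ℕ → W) (n : ℕ) => ω (n + 1) :=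
    continuous_pi fun n => continuous_apply (n + 1)
  let T : C(ℕ → W, K) → C(ℕ → W, K) := fun Y =>
    ⟨fun ω => g (ω 0) (Y fun n => ω (n + 1)), by
      exact hgc.comp ((continuous_apply 0).prodMk (Y.continuous.comp hshift))⟩
  have hT : ContractingWith (⟨θ, hθ0⟩ : NNReal) T := by
    refine ⟨by exact_mod_cast hθ, LipschitzWith.of_dist_le_mul fun Y Y' => ?_⟩
    rw [ContinuousMap.dist_le (by positivity)]
    intro ω
    refine (hg _ _ _).trans ?_
    exact mul_le_mul_of_nonneg_left (ContinuousMap.dist_apply_le_dist _) hθ0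
  have : Nonempty C(ℕ → W, K) := ⟨ContinuousMap.const _ (Classical.arbitrary K)⟩
  obtain ⟨Y, hY⟩ : ∃ Y, T Y = Y := ⟨_, hT.fixedPoint_isFixedPt⟩
  exact ⟨Y, Y.continuous, fun ω => (DFunLike.congr_fun hY ω).symm⟩

/-! ### A cone of directions that tolerates small rotations. -/

section Separation

/-- The argument of `ζ` is at most `π / 3` in absolute value, and `ζ ≠ 0`. -/
def InCone (ζ : ℂ) : Prop := 0 < ζ.re ∧ ‖ζ‖ ≤ 2 * ζ.re

theorem InCone.of_near {ζ : ℂ} {x e m : ℝ} (hm : 0 < m) (hx : m ≤ x) (he : 4 * e ≤ m)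
    (h : ‖ζ - x‖ ≤ e) : InCone ζ := by
  have h1 : x - e ≤ ζ.re := by
    have := (Complex.abs_re_le_norm (ζ - x)).trans h
    rw [Complex.sub_re, Complex.ofReal_re] at this
    linarith [(abs_le.mp this).1]
  have h2 : ‖ζ‖ ≤ x + e := by
    calc ‖ζ‖ = ‖(x : ℂ) + (ζ - x)‖ := by ring_nf
      _ ≤ ‖(x : ℂ)‖ + ‖ζ - x‖ := norm_add_le _ _
      _ ≤ x + e := by
        rw [Complex.norm_real, Real.norm_eq_abs, abs_of_pos (by linarith)]
        linarith
  constructor <;> linarith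

/-- The perturbation `(u - 1) ζ` has norm at most `2 ζ.re / 4`, half of the real part. -/
theorem InCone.re_mul_pos {ζ u : ℂ} (hζ : InCone ζ) (hu : ‖u - 1‖ ≤ 1 / 4) : 0 < (u * ζ).re := by
  have h1 : (u * ζ).re = ζ.re + ((u - 1) * ζ).re := by
    rw [← Complex.add_re]; ring_nf
  have h2 := (Complex.abs_re_le_norm ((u - 1) * ζ))
  rw [norm_mul] at h2
  have h3 : ‖u - 1‖ * ‖ζ‖ ≤ 1 / 4 * (2 * ζ.re) :=
    mul_le_mul hu hζ.2 (norm_nonneg _) (by norm_num)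
  have := hζ.1
  linarith [(abs_le.mp h2).1]

theorem norm_mul_sub_one_le {u v : ℂ} (hu : ‖u‖ ≤ 1) : ‖u * v - 1‖ ≤ ‖u - 1‖ + ‖v - 1‖ := by
  calc ‖u * v - 1‖ = ‖(u - 1) + u * (v - 1)‖ := by ring_nf
    _ ≤ ‖u - 1‖ + ‖u * (v - 1)‖ := norm_add_le _ _
    _ ≤ ‖u - 1‖ + ‖v - 1‖ := by
      rw [norm_mul]
      gcongr
      exact mul_le_of_le_one_left (norm_nonneg _) hu

theorem norm_pow_sub_one_le {u : ℂ} (hu : ‖u‖ ≤ 1) (n : ℕ) : ‖u ^ n - 1‖ ≤ n * ‖u - 1‖ := by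
  induction n with
  | zero => simp
  | succ n ih =>
    rw [pow_succ']
    refine (norm_mul_sub_one_le hu).trans ?_
    push_cast
    linarith

/-- A few factors of small argument do not move a point of the cone to the left half plane. -/
theorem InCone.re_mul_mul_pow_pos {a b ζ : ℂ} {η : ℝ} {n : ℕ} (hζ : InCone ζ) (ha : a ≠ 0)
    (hb : b ≠ 0) (ha' : ‖a / ‖a‖ - 1‖ ≤ η) (hb' : ‖b / ‖b‖ - 1‖ ≤ η)
    (hη : (n + 1) * η ≤ 1 / 4) : 0 < (a * (b ^ n * ζ)).re := by
  have hna : (‖a‖ : ℂ) ≠ 0 := by exact_mod_cast norm_ne_zero_iff.mpr ha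
  have hnb : (‖b‖ : ℂ) ≠ 0 := by exact_mod_cast norm_ne_zero_iff.mpr hb
  have hua : ‖a / ‖a‖‖ ≤ 1 := by
    rw [norm_div, Complex.norm_real, norm_norm, div_self (norm_ne_zero_iff.mpr ha)]
  have hub : ‖b / ‖b‖‖ ≤ 1 := by
    rw [norm_div, Complex.norm_real, norm_norm, div_self (norm_ne_zero_iff.mpr hb)]
  have heq : a * (b ^ n * ζ) = ((‖a‖ * ‖b‖ ^ n : ℝ) : ℂ) * ((a / ‖a‖ * (b / ‖b‖) ^ n) * ζ) := by
    push_cast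
    rw [div_pow]
    field_simp
  rw [heq, Complex.re_ofReal_mul]
  refine mul_pos (by positivity) (hζ.re_mul_pos ?_)
  refine (norm_mul_sub_one_le hua).trans ?_
  have := norm_pow_sub_one_le hub n
  have h3 : (n : ℝ) * ‖b / ‖b‖ - 1‖ ≤ n * η := by gcongr
  linarith

end Separation

/-! ### Disjointness of the pieces of a nearly straight curve. -/

section Curve

variable {ι : Type*} [Fintype ι] [LinearOrder ι] {h p : ι → ℝ} {c : ι → ℂ} {F : ℝ → ℂ}
  {e ρ : ℝ}

/-- Each coefficient error enters at most once, for a total of at most `e`, while the error of the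
point is contracted. The recursion `δ ↦ e + ρ δ` has the fixed point `e / (1 - ρ)`. -/
theorem norm_cell_sub_le (hce : ∑ i, ‖c i - p i‖ ≤ e)
    (hcρ : ∀ j, ‖c j‖ ≤ ρ) (j : ι) (z : ℂ) {s δ : ℝ} (hs : s ∈ Icc (0 : ℝ) 1) (hz : ‖z - s‖ ≤ δ) :
    ‖lowerSum c j + c j * z - ((lowerSum p j + p j * s : ℝ) : ℂ)‖ ≤ e + ρ * δ := by
  have h1 : lowerSum c j + c j * z - ((lowerSum p j + p j * s : ℝ) : ℂ) =
      lowerSum (fun i => c i - p i) j + (c j - p j) * s + c j * (z - s) := by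
    simp only [lowerSum, Finset.sum_sub_distrib]
    push_cast
    ring
  have h2 : ‖lowerSum (fun i => c i - (p i : ℂ)) j‖ + ‖(c j - p j) * s‖ ≤ e := by
    calc _ ≤ lowerSum (fun i => ‖c i - p i‖) j + ‖c j - p j‖ := by
          gcongr
          · exact norm_sum_le _ _
          · rw [norm_mul, Complex.norm_real, Real.norm_eq_abs, abs_of_nonneg hs.1]
            exact mul_le_of_le_one_right (norm_nonneg _) hs.2
      _ ≤ ∑ i, ‖c i - p i‖ := lowerSum_add_le_sum (fun i => norm_nonneg _) j
      _ ≤ e := hce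
  rw [h1]
  refine (norm_add_le _ _).trans (add_le_add ((norm_add_le _ _).trans h2) ?_)
  rw [norm_mul]
  exact mul_le_mul (hcρ j) hz (norm_nonneg _) ((norm_nonneg _).trans (hcρ j))

/-- If the coefficients are close to a positive probability vector, the curve is close to the
segment `[0,1]`. -/
theorem IsDeRhamCurve.exists_norm_sub_le (hF : IsDeRhamCurve h c F) (h0 : ∀ j, 0 < h j)
    (h1 : ∑ j, h j = 1) (hp : ∀ j, 0 < p j) (hp1 : ∑ j, p j = 1)
    (hce : ∑ i, ‖c i - p i‖ ≤ e) (hρ0 : 0 ≤ ρ) (hρ : ρ < 1) (hcρ : ∀ j, ‖c j‖ ≤ ρ) {y : ℝ}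
    (hy : y ∈ Icc (0 : ℝ) 1) : ∃ s ∈ Icc (0 : ℝ) 1, ‖F y - (s : ℂ)‖ ≤ e / (1 - ρ) := by
  -- The segment is taken as a set: a cell has width `h j` in the parameter but `p j` on the
  -- segment, so `F y` need not be near `y`.
  set S : Set ℂ := (fun s : ℝ => (s : ℂ)) '' Icc (0 : ℝ) 1 with hS
  have hSc : IsCompact S := isCompact_Icc.image Complex.continuous_ofReal
  have hSn : S.Nonempty := ⟨_, mem_image_of_mem _ (left_mem_Icc.mpr zero_le_one)⟩
  have hatt : ∀ z : ℂ, ∃ s ∈ Icc (0 : ℝ) 1, Metric.infDist z S = ‖z - (s : ℂ)‖ := by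
    intro z
    obtain ⟨_, ⟨s, hs, rfl⟩, hz⟩ := hSc.exists_infDist_eq_dist hSn z
    exact ⟨s, hs, by rw [hz, dist_eq_norm]⟩
  have hcont : ContinuousOn (fun y => Metric.infDist (F y) S) (Icc 0 1) :=
    (Metric.continuous_infDist_pt S).comp_continuousOn hF.continuousOn
  obtain ⟨B, hB⟩ := isCompact_Icc.exists_bound_of_continuousOn hcont
  have := le_div_of_forall_exists_le (s := Icc (0 : ℝ) 1) (g := fun y => Metric.infDist (F y) S)
    (e := e) (B := B) hρ0 hρ (fun x hx => (Real.le_norm_self _).trans (hB x hx)) (by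
      intro y hy
      obtain ⟨j, t, ht, rfl, -⟩ := exists_cell_eq h0 h1 hy
      refine ⟨t, ht, ?_⟩
      obtain ⟨s, hs, hz⟩ := hatt (F t)
      rw [hF.map_cell j t ht]
      refine (Metric.infDist_le_dist_of_mem
        (mem_image_of_mem (fun s : ℝ => (s : ℂ)) (cell_mem_Icc hp hp1 j hs))).trans ?_
      rw [dist_eq_norm]
      exact norm_cell_sub_le hce hcρ j (F t) hs hz.ge) y hy
  obtain ⟨s, hs, hz⟩ := hatt (F y)
  exact ⟨s, hs, hz ▸ this⟩

theorem IsDeRhamCurve.exists_cell_norm_sub_le (hF : IsDeRhamCurve h c F) (h0 : ∀ j, 0 < h j)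
    (h1 : ∑ j, h j = 1) (hp : ∀ j, 0 < p j) (hp1 : ∑ j, p j = 1)
    (hce : ∑ i, ‖c i - p i‖ ≤ e) (hρ0 : 0 ≤ ρ) (hρ : ρ < 1) (hcρ : ∀ j, ‖c j‖ ≤ ρ) (j : ι) {y : ℝ}
    (hy : y ∈ Icc (0 : ℝ) 1) :
    ∃ x : ℝ, lowerSum p j ≤ x ∧ x ≤ lowerSum p j + p j ∧
      ‖lowerSum c j + c j * F y - (x : ℂ)‖ ≤ e / (1 - ρ) := by
  obtain ⟨s, hs, hz⟩ := hF.exists_norm_sub_le h0 h1 hp hp1 hce hρ0 hρ hcρ hy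
  refine ⟨lowerSum p j + p j * s, ?_, ?_, ?_⟩
  · have := mul_nonneg (hp j).le hs.1
    linarith
  · have := mul_le_of_le_one_right (hp j).le hs.2
    linarith
  · refine (norm_cell_sub_le hce hcρ j (F y) hs hz).trans_eq ?_
    have : 1 - ρ ≠ 0 := by linarith
    field_simp
    ring

variable {bot top : ι} {m₀ : ℝ}

theorem lowerSum_ge_of_ne_isMin (hp : ∀ j, 0 < p j) (hbot : IsMin bot) {b : ι} (hb : b ≠ bot) :
    p bot ≤ lowerSum p b := by
  have hlt : bot < b := lt_of_le_of_ne ((le_total bot b).elim id fun h => hbot h) (Ne.symm hb)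
  have := lowerSum_add_le (fun i => (hp i).le) hlt
  rwa [lowerSum_of_isMin p hbot, zero_add] at this

theorem lowerSum_add_le_of_ne_isMax (hp : ∀ j, 0 < p j) (hp1 : ∑ j, p j = 1) (htop : IsMax top)
    {b : ι} (hb : b ≠ top) : lowerSum p b + p b ≤ 1 - p top := by
  have hlt : b < top := lt_of_le_of_ne ((le_total b top).elim id fun h => htop h) hb
  have := lowerSum_add_le (fun i => (hp i).le) hlt
  have h2 := lowerSum_add_of_isMax p htop
  linarith

/-- A point of a cell that is not on the boundary of the curve near the left end is a rotated point
of the cone, the rotation being the one of the leading run of the first symbol. -/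
theorem IsDeRhamCurve.exists_pow_mul_cone (hF : IsDeRhamCurve h c F) (h0 : ∀ j, 0 < h j)
    (h1 : ∑ j, h j = 1) (hp : ∀ j, 0 < p j) (hp1 : ∑ j, p j = 1)
    (hce : ∑ i, ‖c i - p i‖ ≤ e) (hρ0 : 0 ≤ ρ) (hρ : ρ < 1) (hcρ : ∀ j, ‖c j‖ ≤ ρ)
    (hm₀ : 0 < m₀) (hpm : ∀ j, m₀ ≤ p j) (he : 4 * (e / (1 - ρ)) ≤ m₀) (hbot : IsMin bot)
    {t : ℝ} (ht : t ∈ Icc (0 : ℝ) 1) (v : List ι) (hv : ∃ b ∈ v, b ≠ bot) :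
    ∃ n ≤ v.length, ∃ ζ, InCone ζ ∧ curveMap c v (F t) = c bot ^ n * ζ := by
  induction v with
  | nil => simp at hv
  | cons x v ih =>
    by_cases hx : x = bot
    · obtain ⟨b, hb, hbb⟩ := hv
      have hbv : b ∈ v := by
        rcases List.mem_cons.mp hb with rfl | h'
        · exact absurd hx hbb
        · exact h'
      obtain ⟨n, hn, ζ, hζ, heq⟩ := ih ⟨b, hbv, hbb⟩
      refine ⟨n + 1, by simpa using hn, ζ, hζ, ?_⟩
      rw [curveMap_cons, hx, lowerSum_of_isMin c hbot, heq]
      ring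
    -- The run of the first symbol has ended: the point is near a real number at least `p bot`,
    -- hence in the cone.
    · refine ⟨0, Nat.zero_le _, _, ?_, by rw [pow_zero, one_mul]⟩
      rw [curveMap_cons, ← hF.wordMap h0 h1 v ht]
      obtain ⟨x', hx1, -, hx3⟩ := hF.exists_cell_norm_sub_le h0 h1 hp hp1 hce hρ0 hρ hcρ x
        (wordMap_mem_Icc h0 h1 v ht)
      exact InCone.of_near hm₀
        (((hpm bot).trans (lowerSum_ge_of_ne_isMin hp hbot hx)).trans hx1) he hx3

/-- Mirror image of `IsDeRhamCurve.exists_pow_mul_cone`: since `∑ c = 1`, the last similarity fixes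
1, and each leading `top` multiplies the distance vector to 1 by `c top`. -/
theorem IsDeRhamCurve.exists_one_sub_pow_mul_cone (hF : IsDeRhamCurve h c F) (h0 : ∀ j, 0 < h j)
    (h1 : ∑ j, h j = 1) (hc1 : ∑ j, c j = 1) (hp : ∀ j, 0 < p j) (hp1 : ∑ j, p j = 1)
    (hce : ∑ i, ‖c i - p i‖ ≤ e) (hρ0 : 0 ≤ ρ) (hρ : ρ < 1) (hcρ : ∀ j, ‖c j‖ ≤ ρ)
    (hm₀ : 0 < m₀) (hpm : ∀ j, m₀ ≤ p j) (he : 4 * (e / (1 - ρ)) ≤ m₀) (htop : IsMax top)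
    {t : ℝ} (ht : t ∈ Icc (0 : ℝ) 1) (v : List ι) (hv : ∃ b ∈ v, b ≠ top) :
    ∃ n ≤ v.length, ∃ ζ, InCone ζ ∧ 1 - curveMap c v (F t) = c top ^ n * ζ := by
  induction v with
  | nil => simp at hv
  | cons x v ih =>
    by_cases hx : x = top
    · obtain ⟨b, hb, hbb⟩ := hv
      have hbv : b ∈ v := by
        rcases List.mem_cons.mp hb with rfl | h'
        · exact absurd hx hbb
        · exact h'
      obtain ⟨n, hn, ζ, hζ, heq⟩ := ih ⟨b, hbv, hbb⟩
      refine ⟨n + 1, by simpa using hn, ζ, hζ, ?_⟩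
      have hsum := lowerSum_add_of_isMax c htop
      rw [hc1] at hsum
      rw [curveMap_cons, hx, pow_succ', mul_assoc, ← heq]
      linear_combination -hsum
    · refine ⟨0, Nat.zero_le _, _, ?_, by rw [pow_zero, one_mul]⟩
      rw [curveMap_cons, ← hF.wordMap h0 h1 v ht]
      obtain ⟨x', -, hx2, hx3⟩ := hF.exists_cell_norm_sub_le h0 h1 hp hp1 hce hρ0 hρ hcρ x
        (wordMap_mem_Icc h0 h1 v ht)
      have hx4 := lowerSum_add_le_of_ne_isMax hp hp1 htop hx
      have hx5 := hpm top
      refine InCone.of_near (x := 1 - x') hm₀ (by linarith) he ?_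
      rw [norm_sub_rev] at hx3
      refine (congrArg norm ?_).trans_le hx3
      push_cast
      ring

/-- The parts of the curve over different cells do not meet, away from long runs of the extreme
symbols. -/
theorem IsDeRhamCurve.cell_ne_cell (hF : IsDeRhamCurve h c F) (h0 : ∀ j, 0 < h j)
    (h1 : ∑ j, h j = 1) (hc1 : ∑ j, c j = 1) (hc0 : ∀ j, c j ≠ 0) (hp : ∀ j, 0 < p j)
    (hp1 : ∑ j, p j = 1) (hce : ∑ i, ‖c i - p i‖ ≤ e) (hρ0 : 0 ≤ ρ) (hρ : ρ < 1)
    (hcρ : ∀ j, ‖c j‖ ≤ ρ) (hm₀ : 0 < m₀) (hpm : ∀ j, m₀ ≤ p j) (he : 4 * (e / (1 - ρ)) ≤ m₀)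
    (hbot : IsMin bot) (htop : IsMax top) {η : ℝ} (hη : ∀ j, ‖c j / ‖c j‖ - 1‖ ≤ η) {L : ℕ}
    (hL : (L + 1) * η ≤ 1 / 4) {i j : ι} (hij : i < j) {v v' : List ι} {t t' : ℝ}
    (ht : t ∈ Icc (0 : ℝ) 1) (ht' : t' ∈ Icc (0 : ℝ) 1) (hvL : v.length ≤ L)
    (hvL' : v'.length ≤ L) (hv : ∃ b ∈ v, b ≠ top) (hv' : ∃ b ∈ v', b ≠ bot) :
    lowerSum c i + c i * curveMap c v (F t) ≠ lowerSum c j + c j * curveMap c v' (F t') := by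
  have hη0 : 0 ≤ η := (norm_nonneg _).trans (hη i)
  have hbound : ∀ n ≤ L, ((n : ℝ) + 1) * η ≤ 1 / 4 := by
    intro n hn
    have : (n : ℝ) ≤ L := by exact_mod_cast hn
    nlinarith
  obtain ⟨n, hn, ζ, hζ, heq⟩ := hF.exists_one_sub_pow_mul_cone h0 h1 hc1 hp hp1 hce hρ0 hρ hcρ
    hm₀ hpm he htop ht v hv
  obtain ⟨n', hn', ζ', hζ', heq'⟩ := hF.exists_pow_mul_cone h0 h1 hp hp1 hce hρ0 hρ hcρ
    hm₀ hpm he hbot ht' v' hv'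
  have hre := hζ.re_mul_mul_pow_pos (hc0 i) (hc0 top) (hη i) (hη top) (hbound n (hn.trans hvL))
  have hre' := hζ'.re_mul_mul_pow_pos (hc0 j) (hc0 bot) (hη j) (hη bot)
    (hbound n' (hn'.trans hvL'))
  rw [← heq] at hre
  rw [← heq'] at hre'
  have hmid : 0 ≤ (∑ m with i < m ∧ m < j, c m).re := by
    rw [Complex.re_sum]
    refine Finset.sum_nonneg fun m _ => ?_
    have h1 : InCone 1 := by constructor <;> simp
    have := h1.re_mul_mul_pow_pos (n := 0) (hc0 m) (hc0 m) (hη m) (hη m)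
      (by simpa using hbound 0 (Nat.zero_le _))
    simpa using this.le
  intro hcon
  rw [lowerSum_add_sum_between c hij] at hcon
  -- The difference of the two points consists of the remainder of piece `i`, the whole pieces in
  -- between and the beginning of piece `j`. The outer terms have positive real part and the middle
  -- one nonnegative, so the sum cannot vanish.
  have hzero : c i * (1 - curveMap c v (F t)) + ∑ m with i < m ∧ m < j, c m +
      c j * curveMap c v' (F t') = 0 := by
    linear_combination -hcon
  have := congrArg Complex.re hzero
  rw [Complex.add_re, Complex.add_re, Complex.zero_re] at this
  linarith

end Curve

theorem exists_common_prefix {α : Type*} {w w' : List α} (hlen : w.length = w'.length)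
    (hne : w ≠ w') : ∃ u i a j b, i ≠ j ∧ w = u ++ i :: a ∧ w' = u ++ j :: b := by
  induction w generalizing w' with
  | nil =>
    cases w' with
    | nil => exact absurd rfl hne
    | cons => simp at hlen
  | cons x w ih =>
    cases w' with
    | nil => simp at hlen
    | cons x' w' =>
      by_cases hx : x = x'
      · subst hx
        obtain ⟨u, i, a, j, b, hij, rfl, rfl⟩ := ih (by simpa using hlen)
          (fun hcon => hne (by rw [hcon]))
        exact ⟨x :: u, i, a, j, b, hij, rfl, rfl⟩
      · exact ⟨[], x, w, x', w', hx, rfl, rfl⟩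

end Dimension

/-- The real part is 1-Lipschitz and, by the intermediate value theorem, takes all values in
`[0,1]`. This bound serves wavenumber zero, where no block length is provided. -/
theorem IsDeRhamCurve.one_le_dimH {ι : Type*} [Fintype ι] [LinearOrder ι] {h : ι → ℝ} {c : ι → ℂ}
    {F : ℝ → ℂ} (hF : IsDeRhamCurve h c F) : 1 ≤ dimH (F '' Icc 0 1) := by
  have hre : LipschitzWith 1 Complex.re :=
    LipschitzWith.of_dist_le_mul fun z w => by
      rw [NNReal.coe_one, one_mul, Real.dist_eq, dist_eq_norm, ← Complex.sub_re]
      exact Complex.abs_re_le_norm _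
  have hsub : Icc (0 : ℝ) 1 ⊆ Complex.re '' (F '' Icc 0 1) := by
    have := intermediate_value_Icc zero_le_one
      (Complex.continuous_re.comp_continuousOn hF.continuousOn)
    rw [image_image]
    simpa [hF.zero, hF.one] using this
  have hI : dimH (Icc (0 : ℝ) 1) = 1 := by
    rw [Real.dimH_of_nonempty_interior (by simp), Module.finrank_self, Nat.cast_one]
  rw [← hI]
  exact (dimH_mono hsub).trans (hre.dimH_image_le _)

theorem one_sub_half_ge_exp_neg {x : ℝ} (h0 : 0 ≤ x) (h1 : x ≤ 1) :
    Real.exp (-x) ≤ 1 - x / 2 := by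
  rw [Real.exp_neg, inv_le_iff_one_le_mul₀ (Real.exp_pos x)]
  nlinarith [Real.add_one_le_exp x]

/-! ### Lower bound for the Hausdorff dimension from mixed words. -/

section Curve

variable {ι : Type*} [Fintype ι] [LinearOrder ι] {h p : ι → ℝ} {c : ι → ℂ} {F : ℝ → ℂ}
  {e ρ : ℝ} {bot top : ι} {m₀ : ℝ}

/-- The words of length `M` that are not a power of the first or of the last symbol. -/
abbrev MixedWord (ι : Type*) (bot top : ι) (M : ℕ) : Type _ :=
  {w : Fin M → ι // (∃ i, w i ≠ bot) ∧ ∃ i, w i ≠ top}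

omit [Fintype ι] [LinearOrder ι] in
theorem wordRatio_pos (hc0 : ∀ j, c j ≠ 0) (w : List ι) : 0 < wordRatio c w :=
  List.prod_pos (by
    simp only [List.mem_map]
    rintro _ ⟨j, -, rfl⟩
    exact norm_pos_iff.mpr (hc0 j))

/-- The mixed words carry almost the full weight. -/
theorem le_sum_mixedWord (hcρ : ∀ j, ‖c j‖ ≤ ρ) (hρ0 : 0 ≤ ρ) (hρ : ρ < 1) {d : ℝ} (hd : 1 ≤ d)
    (hsum : ∑ j, ‖c j‖ ^ d = 1) (M : ℕ) [Fintype (MixedWord ι bot top M)] :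
    1 - 2 * ρ ^ M ≤ ∑ w : MixedWord ι bot top M, wordRatio c (List.ofFn w.1) ^ d := by
  classical
  have hR0 : ∀ w : Fin M → ι, 0 ≤ wordRatio c (List.ofFn w) := fun w => by
    rw [wordRatio_ofFn]
    exact Finset.prod_nonneg fun _ _ => norm_nonneg _
  have htot := sum_wordRatio_rpow c d M
  rw [hsum, one_pow] at htot
  have hsub : ∑ w : MixedWord ι bot top M, wordRatio c (List.ofFn w.1) ^ d =
      ∑ w with (∃ i, w i ≠ bot) ∧ ∃ i, w i ≠ top, wordRatio c (List.ofFn w) ^ d :=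
    (Finset.sum_subtype _ (by simp) fun w : Fin M → ι => wordRatio c (List.ofFn w) ^ d).symm
  rw [hsub, ← htot, ← Finset.sum_filter_add_sum_filter_not Finset.univ
    (fun w : Fin M → ι => (∃ i, w i ≠ bot) ∧ ∃ i, w i ≠ top), sub_le_iff_le_add]
  gcongr
  -- At most two words are discarded, and since `d ≥ 1` each weighs no more than its ratio, at most
  -- `ρ ^ M`.
  have hss : (Finset.univ.filter fun w : Fin M → ι => ¬((∃ i, w i ≠ bot) ∧ ∃ i, w i ≠ top)) ⊆
      {fun _ => bot, fun _ => top} := by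
    intro w hw
    simp only [Finset.mem_filter, Finset.mem_univ, true_and, not_and_or, not_exists,
      not_not] at hw
    simp only [Finset.mem_insert, Finset.mem_singleton]
    exact hw.imp funext funext
  calc _ ≤ ∑ w ∈ {fun _ => bot, fun _ => top}, wordRatio c (List.ofFn (n := M) w) ^ d :=
        Finset.sum_le_sum_of_subset_of_nonneg hss fun w _ _ => Real.rpow_nonneg (hR0 w) _
    _ ≤ ∑ w ∈ ({fun _ => bot, fun _ => top} : Finset (Fin M → ι)), ρ ^ M := by
        refine Finset.sum_le_sum fun w _ => ?_
        have h1 := wordRatio_ofFn_le hcρ w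
        calc wordRatio c (List.ofFn w) ^ d ≤ wordRatio c (List.ofFn w) ^ (1 : ℝ) :=
              Real.rpow_le_rpow_of_exponent_ge' (hR0 w) (h1.trans (pow_le_one₀ hρ0 hρ.le))
                zero_le_one hd
          _ = wordRatio c (List.ofFn w) := Real.rpow_one _
          _ ≤ ρ ^ M := h1
    _ ≤ 2 * ρ ^ M := by
        rw [Finset.sum_const, nsmul_eq_mul]
        gcongr
        exact_mod_cast Finset.card_le_two

/-- The Hausdorff dimension of the curve is at least its similarity dimension, up to an
exponentially small term in the number of symbols after which the curve can wind by `π / 2`. -/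
theorem IsDeRhamCurve.le_dimH (hF : IsDeRhamCurve h c F) (h0 : ∀ j, 0 < h j)
    (h1 : ∑ j, h j = 1) (hc1 : ∑ j, c j = 1) (hc0 : ∀ j, c j ≠ 0) (hp : ∀ j, 0 < p j)
    (hp1 : ∑ j, p j = 1) (hce : ∑ i, ‖c i - p i‖ ≤ e) (hρ0 : 0 < ρ) (hρ : ρ < 1)
    (hhρ : ∀ j, h j ≤ ρ)
    (hcρ : ∀ j, ‖c j‖ ≤ ρ) (hm₀ : 0 < m₀) (hpm : ∀ j, m₀ ≤ p j) (he : 4 * (e / (1 - ρ)) ≤ m₀)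
    (hbot : IsMin bot) (htop : IsMax top) {η : ℝ} (hη : ∀ j, ‖c j / ‖c j‖ - 1‖ ≤ η) {M : ℕ}
    (hM : 1 ≤ M) (hMη : (2 * M + 1) * η ≤ 1 / 4) (hMρ : 4 * ρ ^ M ≤ 1) {d : ℝ} (hd : 1 ≤ d)
    (hsum : ∑ j, ‖c j‖ ^ d = 1) :
    ENNReal.ofReal (d - 4 * ρ ^ M / Real.log ρ⁻¹) ≤ dimH (F '' Icc 0 1) := by
  classical
  -- The loss of exponent that pays for normalizing the weights by `Z`: it is chosen so that `(ρ ^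
  -- M) ^ τ = exp (-4 M ρ ^ M)`, which is at most `1 - 2 ρ ^ M ≤ Z`.
  set τ := 4 * ρ ^ M / Real.log ρ⁻¹ with hτ
  have hlog : 0 < Real.log ρ⁻¹ := Real.log_pos ((one_lt_inv₀ hρ0).mpr hρ)
  have hτ0 : 0 < τ := by positivity
  rcases le_or_gt (d - τ) 0 with hs | hs
  · rw [ENNReal.ofReal_of_nonpos hs]
    exact bot_le
  let W := MixedWord ι bot top M
  let : TopologicalSpace W := ⊥
  have : DiscreteTopology W := ⟨rfl⟩
  let R : W → ℝ := fun w => wordRatio c (List.ofFn w.1)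
  have hR0 : ∀ w, 0 < R w := fun w => wordRatio_pos hc0 _
  have hRM : ∀ w, R w ≤ ρ ^ M := fun w => wordRatio_ofFn_le hcρ _
  have hR1 : ∀ w, R w < 1 := fun w => (hRM w).trans_lt (pow_lt_one₀ hρ0.le hρ (by omega))
  set Z := ∑ w, R w ^ d with hZ
  have hZ1 : 1 - 2 * ρ ^ M ≤ Z := le_sum_mixedWord hcρ hρ0.le hρ hd hsum M
  have hZ0 : 0 < Z := by linarith
  let g : W → Icc (0 : ℝ) 1 → Icc (0 : ℝ) 1 := fun w t =>
    ⟨MultiBaker.wordMap h (List.ofFn w.1) t, wordMap_mem_Icc h0 h1 _ t.2⟩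
  obtain ⟨Y, hYc, hY⟩ := exists_coding g hρ0.le hρ fun w x y =>
    dist_wordMap_le h0 hρ.le hhρ _ (by
      rw [Ne, List.ofFn_eq_nil_iff]
      omega) _ _
  let π : (ℕ → W) → ℂ := fun ω => F (Y ω)
  have hπc : Continuous π :=
    hF.continuousOn.comp_continuous (continuous_subtype_val.comp hYc) fun ω => (Y ω).2
  have hπ : ∀ ω, π ω = curveMap c (List.ofFn (ω 0).1) (π fun n => ω (n + 1)) := by
    intro ω
    simp only [π]
    rw [← hF.wordMap h0 h1 _ (Y _).2, hY ω]
  have hinj : ∀ ω ω' : ℕ → W, ω 0 ≠ ω' 0 → π ω ≠ π ω' := by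
    intro ω ω' hne
    have hne' : List.ofFn (ω 0).1 ≠ List.ofFn (ω' 0).1 := fun hcon =>
      hne (Subtype.ext (List.ofFn_injective hcon))
    obtain ⟨u, i, a, j, b, hij, hw, hw'⟩ := exists_common_prefix (by simp) hne'
    have htail : ∀ (ω : ℕ → W) (u : List ι) (i : ι) (a : List ι),
        List.ofFn (ω 0).1 = u ++ i :: a →
        ∃ v : List ι, v.length ≤ 2 * M ∧ (∃ b ∈ v, b ≠ bot) ∧ (∃ b ∈ v, b ≠ top) ∧
          ∃ t ∈ Icc (0 : ℝ) 1,
            π ω = curveMap c u (lowerSum c i + c i * curveMap c v (F t)) := by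
      intro ω u i a hw
      -- The rest of the first block may be a run of an extreme symbol, but the second block is
      -- mixed and ends the run within `2 * M` symbols.
      refine ⟨a ++ List.ofFn (ω 1).1, ?_, ?_, ?_, Y fun n => ω (n + 1 + 1), (Y _).2, ?_⟩
      · have := congrArg List.length hw
        simp only [List.length_ofFn, List.length_append, List.length_cons] at this ⊢
        omega
      · obtain ⟨i, hi⟩ := (ω 1).2.1
        exact ⟨_, List.mem_append_right _ ((List.mem_ofFn' _ _).mpr ⟨i, rfl⟩), hi⟩
      · obtain ⟨i, hi⟩ := (ω 1).2.2
        exact ⟨_, List.mem_append_right _ ((List.mem_ofFn' _ _).mpr ⟨i, rfl⟩), hi⟩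
      · rw [hπ ω, hw, curveMap_append, curveMap_cons, hπ fun n => ω (n + 1), curveMap_append]
    obtain ⟨v, hv, hvb, hvt, t, ht, heq⟩ := htail ω u i a hw
    obtain ⟨v', hv', hvb', hvt', t', ht', heq'⟩ := htail ω' u j b hw'
    have hMη' : (((2 * M : ℕ) : ℝ) + 1) * η ≤ 1 / 4 := by push_cast; exact hMη
    rw [heq, heq', ← dist_pos, dist_curveMap]
    refine mul_pos (wordRatio_pos hc0 u) (dist_pos.mpr ?_)
    rcases lt_or_gt_of_ne hij with hlt | hlt
    · exact hF.cell_ne_cell h0 h1 hc1 hc0 hp hp1 hce hρ0.le hρ hcρ hm₀ hpm he hbot htop hη hMη'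
        hlt ht ht' hv hv' hvt hvb'
    · exact (hF.cell_ne_cell h0 h1 hc1 hc0 hp hp1 hce hρ0.le hρ hcρ hm₀ hpm he hbot htop hη hMη'
        hlt ht' ht hv' hv hvt' hvb).symm
  -- Pairs of codes with different first blocks form a compact set, so the distance of their points,
  -- never zero, is bounded below.
  obtain ⟨ε, hε, hsep0⟩ : ∃ ε > 0, ∀ ω ω' : ℕ → W, ω 0 ≠ ω' 0 → ε ≤ dist (π ω) (π ω') := by
    have hK : IsCompact {a : (ℕ → W) × (ℕ → W) | a.1 0 ≠ a.2 0} := by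
      refine IsClosed.isCompact ?_
      have : IsClosed {b : W × W | b.1 ≠ b.2} := isClosed_discrete _
      exact this.preimage (f := fun a : (ℕ → W) × (ℕ → W) => (a.1 0, a.2 0)) (by fun_prop)
    rcases Set.eq_empty_or_nonempty {a : (ℕ → W) × (ℕ → W) | a.1 0 ≠ a.2 0} with hemp | hnon
    · refine ⟨1, one_pos, fun ω ω' hne => ?_⟩
      have : (ω, ω') ∈ {a : (ℕ → W) × (ℕ → W) | a.1 0 ≠ a.2 0} := hne
      rw [hemp] at this
      exact absurd this (notMem_empty _)
    · obtain ⟨a, ha, hmin⟩ := hK.exists_isMinOn hnon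
        (f := fun a : (ℕ → W) × (ℕ → W) => dist (π a.1) (π a.2)) (by fun_prop)
      exact ⟨_, dist_pos.mpr (hinj _ _ ha), fun ω ω' hne => hmin (show (ω, ω') ∈ _ from hne)⟩
  have hsep : ∀ n (ω ω' : ℕ → W), (∀ i < n, ω i = ω' i) → ω n ≠ ω' n →
      ε * ∏ i ∈ Finset.range n, R (ω i) ≤ dist (π ω) (π ω') := by
    intro n
    induction n with
    | zero => intro ω ω' _ hne; simpa using hsep0 ω ω' hne
    | succ n ih =>
      intro ω ω' heq hne
      have := ih (fun k => ω (k + 1)) (fun k => ω' (k + 1)) (fun i hi => heq _ (by omega)) hne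
      rw [hπ ω, hπ ω', ← heq 0 (by omega), dist_curveMap, Finset.prod_range_succ', ← mul_assoc,
        mul_comm]
      exact mul_le_mul_of_nonneg_left this (hR0 _).le
  have hq : ∀ w, R w ^ d / Z ≤ R w ^ (d - τ) := by
    intro w
    rw [Real.rpow_sub (hR0 w)]
    refine div_le_div_of_nonneg_left (Real.rpow_nonneg (hR0 w).le _)
      (Real.rpow_pos_of_pos (hR0 w) _) ?_
    calc R w ^ τ ≤ (ρ ^ M) ^ τ := Real.rpow_le_rpow (hR0 w).le (hRM w) hτ0.le
      _ = Real.exp (-(M * (4 * ρ ^ M))) := by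
        rw [Real.rpow_def_of_pos (by positivity), Real.log_pow, hτ, Real.log_inv]
        rw [Real.log_inv] at hlog
        have hne : Real.log ρ ≠ 0 := (neg_pos.mp hlog).ne
        congr 1
        field_simp
      _ ≤ Real.exp (-(4 * ρ ^ M)) := by
        refine Real.exp_le_exp.mpr (neg_le_neg ?_)
        exact le_mul_of_one_le_left (by positivity) (by exact_mod_cast hM)
      _ ≤ 1 - 4 * ρ ^ M / 2 := one_sub_half_ge_exp_neg (by positivity) hMρ
      _ ≤ Z := by linarith
  refine (le_dimH_range_of_separated hπc (q := fun w => R w ^ d / Z) (ratio := R) hs.le hε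
    (fun w => by have := hR0 w; positivity)
    (fun w => (hq w).trans_lt (Real.rpow_lt_one (hR0 w).le (hR1 w) hs))
    (by rw [← Finset.sum_div, div_self hZ0.ne']) hR0 hq
    fun ω ω' n => hsep n ω ω').trans (dimH_mono ?_)
  rintro _ ⟨ω, rfl⟩
  exact mem_image_of_mem F (Y ω).2

end Curve

theorem exp_neg_le_quadratic {z : ℝ} (hz : 0 ≤ z) : Real.exp (-z) ≤ 1 - z + z ^ 2 := by
  rcases le_or_gt z 1 with h | h
  · have := Real.abs_exp_sub_one_sub_id_le (x := -z) (by rwa [abs_neg, abs_of_nonneg hz])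
    have := (abs_le.mp this).2
    nlinarith
  · have := Real.exp_le_one_iff.mpr (neg_nonpos.mpr hz)
    nlinarith

/-- Powers with exponent of order `1 / |k|` are of order `k ^ 4`. -/
theorem exists_length_pow_le {A ρ : ℝ} (hA : 0 < A) (hρ0 : 0 ≤ ρ) (hρ : ρ < 1) :
    ∃ C, 0 ≤ C ∧ ∀ k : ℝ, k ≠ 0 → 12 * A * |k| ≤ 1 →
      ∃ M : ℕ, 1 ≤ M ∧ (2 * M + 1) * (A * |k|) ≤ 1 / 4 ∧ ρ ^ M ≤ C * k ^ 4 := by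
  obtain ⟨B, hB⟩ := (tendsto_pow_const_mul_const_pow_of_lt_one 4 hρ0 hρ).bddAbove_range
  have hB' : ∀ n : ℕ, (n : ℝ) ^ 4 * ρ ^ n ≤ B := fun n => hB ⟨n, rfl⟩
  have hB0 : 0 ≤ B := le_trans (by simp) (hB' 0)
  refine ⟨B * (24 * A) ^ 4, by positivity, fun k hk hAk => ?_⟩
  have hk0 : 0 < A * |k| := mul_pos hA (abs_pos.mpr hk)
  -- For `M = ⌊x⌋ ≥ 1`, `2 * M + 1 ≤ 3 * x` gives the bound `1 / 4`, and `2 * M ≥ x` gives `1 ≤ M *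
  -- (24 * A * |k|)`, whose fourth power converts `ρ ^ M` into a multiple of `k ^ 4`.
  set x := 1 / (12 * (A * |k|)) with hx
  have hx1 : 1 ≤ x := by rw [hx, le_div_iff₀ (by positivity)]; linarith
  have hxk : x * (A * |k|) = 1 / 12 := by rw [hx]; field_simp
  have hM1 : (⌊x⌋₊ : ℝ) ≤ x := Nat.floor_le (by linarith)
  have hM2 : x < ⌊x⌋₊ + 1 := Nat.lt_floor_add_one x
  have hM3 : 1 ≤ ⌊x⌋₊ := Nat.le_floor (by simpa using hx1)
  have hM4 : (1 : ℝ) ≤ ⌊x⌋₊ := by exact_mod_cast hM3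
  refine ⟨⌊x⌋₊, hM3, ?_, ?_⟩
  · nlinarith
  · have h1 : 1 ≤ (⌊x⌋₊ : ℝ) * (24 * A * |k|) := by nlinarith
    have h2 : 1 ≤ ((⌊x⌋₊ : ℝ) * (24 * A * |k|)) ^ 4 := one_le_pow₀ h1
    have h4 : |k| ^ 4 = k ^ 4 := (even_iff_two_dvd.mpr ⟨2, rfl⟩ : Even 4).pow_abs k
    calc ρ ^ ⌊x⌋₊ ≤ ρ ^ ⌊x⌋₊ * ((⌊x⌋₊ : ℝ) * (24 * A * |k|)) ^ 4 :=
          le_mul_of_one_le_right (by positivity) h2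
      _ = ((⌊x⌋₊ : ℝ) ^ 4 * ρ ^ ⌊x⌋₊) * ((24 * A) ^ 4 * |k| ^ 4) := by ring
      _ ≤ B * ((24 * A) ^ 4 * |k| ^ 4) := by gcongr; exact hB' _
      _ = _ := by rw [h4]; ring

/-! ### Expansion of the similarity dimension and of the characteristic function. -/

section Moments

variable {ι : Type*} [Fintype ι] {p a : ι → ℝ}

/-- The sum is at least 1 at exponent 1 because `x ≤ 1`, and tends to 0 because all bases are below
1. -/
theorem exists_critical_exponent [Nonempty ι] {x : ℝ} (hp : ∀ j, 0 < p j) (hp1 : ∑ j, p j = 1)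
    (hx0 : 0 < x) (hx : x ≤ 1) (hpx : ∀ j, p j < x) :
    ∃ d : ℝ, 1 ≤ d ∧ ∑ j, (p j / x) ^ d = 1 := by
  have hb0 : ∀ j, 0 < p j / x := fun j => div_pos (hp j) hx0
  have hb1 : ∀ j, p j / x < 1 := fun j => (div_lt_one hx0).mpr (hpx j)
  have hcont : Continuous fun s : ℝ => ∑ j, (p j / x) ^ s :=
    continuous_finsetSum _ fun j _ => Real.continuous_const_rpow (hb0 j).ne'
  have hlim : Tendsto (fun s : ℝ => ∑ j, (p j / x) ^ s) atTop (𝓝 0) := by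
    rw [← Finset.sum_const_zero (s := (Finset.univ : Finset ι))]
    exact tendsto_finsetSum _ fun j _ =>
      tendsto_rpow_atTop_of_base_lt_one _ (by linarith [hb0 j]) (hb1 j)
  obtain ⟨s, hs, hs1⟩ := ((hlim.eventually (gt_mem_nhds one_pos)).and (eventually_ge_atTop 1)).exists
  have h1 : 1 ≤ ∑ j, (p j / x) ^ (1 : ℝ) := by
    simp_rw [Real.rpow_one]
    rw [← Finset.sum_div, hp1, one_le_div hx0]
    exact hx
  obtain ⟨d, hd, hd1⟩ := intermediate_value_Icc' hs1 hcont.continuousOn ⟨hs.le, h1⟩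
  exact ⟨d, hd.1, hd1⟩

/-- Expansion of the root `d` of `∑ p ^ d = exp (- L d)` for small `L`. -/
theorem abs_exponent_sub_le {d L ℓ : ℝ} (hp : ∀ j, 0 < p j) (hp1 : ∑ j, p j = 1)
    (hℓ : 0 < ℓ) (hpℓ : ∀ j, ℓ ≤ -Real.log (p j)) (hL0 : 0 ≤ L) (hL : 2 * L ≤ ℓ) (hd : 1 ≤ d)
    (hroot : ∑ j, p j ^ d = Real.exp (-(L * d))) :
    |(∑ j, p j * Real.log (1 / p j)) * (d - 1) - L| ≤
      (4 + 2 / ℓ + (∑ j, p j * Real.log (p j) ^ 2) * (2 / ℓ) ^ 2) * L ^ 2 := by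
  set u := d - 1 with hu
  set S := ∑ j, p j * Real.log (p j) ^ 2 with hS
  have hu0 : 0 ≤ u := by linarith
  have hd' : d = 1 + u := by rw [hu]; ring
  have hS0 : 0 ≤ S := Finset.sum_nonneg fun j _ => mul_nonneg (hp j).le (sq_nonneg _)
  have hpow : ∀ j, p j ^ d = p j * Real.exp (-(u * -Real.log (p j))) := by
    intro j
    rw [hd', Real.rpow_add (hp j), Real.rpow_one, Real.rpow_def_of_pos (hp j)]
    congr 2
    ring
  simp_rw [hpow] at hroot
  have hlam : ∑ j, p j * Real.log (1 / p j) = ∑ j, p j * -Real.log (p j) := by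
    simp [Real.log_inv]
  rw [hlam]
  set lam := ∑ j, p j * -Real.log (p j) with hlamdef
  -- A crude bound first: estimating all `p j` by `exp (-ℓ)` gives `u = O(L)`, so that the
  -- second-order terms in `u` below are `O(L ^ 2)`.
  have hu1 : u * ℓ ≤ L * (1 + u) := by
    have : Real.exp (-(L * d)) ≤ Real.exp (-(u * ℓ)) := by
      rw [← hroot]
      calc _ ≤ ∑ j, p j * Real.exp (-(u * ℓ)) := by
            refine Finset.sum_le_sum fun j _ => mul_le_mul_of_nonneg_left ?_ (hp j).le
            refine Real.exp_le_exp.mpr (neg_le_neg ?_)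
            exact mul_le_mul_of_nonneg_left (hpℓ j) hu0
        _ = _ := by rw [← Finset.sum_mul, hp1, one_mul]
    have := Real.exp_le_exp.mp this
    rw [hd'] at this
    linarith
  have hu2 : u * ℓ ≤ 2 * L := by nlinarith
  have hu3 : u ≤ 2 / ℓ * L := by rw [div_mul_eq_mul_div, le_div_iff₀ hℓ]; exact hu2
  have hu4 : u ≤ 1 := by nlinarith
  have hlow : 1 - lam * u ≤ ∑ j, p j * Real.exp (-(u * -Real.log (p j))) := by
    have : 1 - lam * u = ∑ j, p j * (-(u * -Real.log (p j)) + 1) := by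
      simp_rw [mul_add, Finset.sum_add_distrib, mul_one, hp1, hlamdef, Finset.sum_mul]
      rw [sub_eq_neg_add, ← Finset.sum_neg_distrib]
      congr 1
      exact Finset.sum_congr rfl fun j _ => by ring
    rw [this]
    exact Finset.sum_le_sum fun j _ =>
      mul_le_mul_of_nonneg_left (Real.add_one_le_exp _) (hp j).le
  have hupp : ∑ j, p j * Real.exp (-(u * -Real.log (p j))) ≤ 1 - lam * u + S * u ^ 2 := by
    have : 1 - lam * u + S * u ^ 2 =
        ∑ j, p j * (1 - (u * -Real.log (p j)) + (u * -Real.log (p j)) ^ 2) := by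
      simp_rw [mul_add, mul_sub, Finset.sum_add_distrib, Finset.sum_sub_distrib, mul_one, hp1,
        hlamdef, hS, Finset.sum_mul]
      congr 1
      · congr 1
        exact Finset.sum_congr rfl fun j _ => by ring
      · exact Finset.sum_congr rfl fun j _ => by ring
    rw [this]
    refine Finset.sum_le_sum fun j _ => mul_le_mul_of_nonneg_left ?_ (hp j).le
    exact exp_neg_le_quadratic (mul_nonneg hu0 (hℓ.le.trans (hpℓ j)))
  rw [hroot, hd'] at hlow hupp
  have h1 := Real.add_one_le_exp (-(L * (1 + u)))
  have h2 := exp_neg_le_quadratic (z := L * (1 + u)) (by positivity)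
  have h3 : u * L ≤ 2 / ℓ * L ^ 2 := by
    calc u * L ≤ 2 / ℓ * L * L := mul_le_mul_of_nonneg_right hu3 hL0
      _ = _ := by ring
  have h4 : S * u ^ 2 ≤ S * (2 / ℓ) ^ 2 * L ^ 2 := by
    calc S * u ^ 2 ≤ S * (2 / ℓ * L) ^ 2 := by gcongr
      _ = _ := by ring
  have h5 : (L * (1 + u)) ^ 2 ≤ 4 * L ^ 2 := by
    calc (L * (1 + u)) ^ 2 ≤ (L * 2) ^ 2 := by gcongr; linarith
      _ = _ := by ring
  have h6 : 0 ≤ 2 / ℓ * L ^ 2 := by positivity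
  have h7 : 0 ≤ S * (2 / ℓ) ^ 2 * L ^ 2 := by positivity
  have h8 : 0 ≤ u * L := by positivity
  rw [abs_le]
  constructor <;> nlinarith

/-- The characteristic function of the jumps `a` with probabilities `p`. -/
noncomputable def charSum (p a : ι → ℝ) (k : ℝ) : ℂ :=
  ∑ j, (p j : ℂ) * Complex.exp (-(Complex.I * k * a j))

/-- Only differences of jumps survive: the drift drops out and the modulus is even in `k`, which is
why the error after the quadratic term has order 4. -/
theorem normSq_charSum (p a : ι → ℝ) (k : ℝ) :
    ‖charSum p a k‖ ^ 2 = ∑ i, ∑ j, p i * p j * Real.cos (k * (a i - a j)) := by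
  have hexp : ∀ j, Complex.exp (-(Complex.I * k * a j)) =
      (Real.cos (k * a j) : ℂ) - (Real.sin (k * a j) : ℂ) * Complex.I := by
    intro j
    have : -(Complex.I * k * a j) = ((-(k * a j) : ℝ) : ℂ) * Complex.I := by push_cast; ring
    rw [this, Complex.exp_mul_I, ← Complex.ofReal_cos, ← Complex.ofReal_sin, Real.cos_neg,
      Real.sin_neg]
    push_cast
    ring
  have hre : (charSum p a k).re = ∑ j, p j * Real.cos (k * a j) := by
    simp only [charSum, hexp, Complex.re_sum, Complex.re_ofReal_mul]
    refine Finset.sum_congr rfl fun j _ => ?_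
    rw [Complex.sub_re, Complex.ofReal_re, Complex.re_ofReal_mul, Complex.I_re]
    ring
  have him : (charSum p a k).im = -∑ j, p j * Real.sin (k * a j) := by
    simp only [charSum, hexp, Complex.im_sum, Complex.im_ofReal_mul]
    rw [← Finset.sum_neg_distrib]
    refine Finset.sum_congr rfl fun j _ => ?_
    rw [Complex.sub_im, Complex.ofReal_im, Complex.im_ofReal_mul, Complex.I_im]
    ring
  rw [← Complex.normSq_eq_norm_sq, Complex.normSq_apply, hre, him, neg_mul_neg,
    Finset.sum_mul_sum, Finset.sum_mul_sum, ← Finset.sum_add_distrib]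
  refine Finset.sum_congr rfl fun i _ => ?_
  rw [← Finset.sum_add_distrib]
  refine Finset.sum_congr rfl fun j _ => ?_
  rw [mul_sub, Real.cos_sub]
  ring

/-- Half of the variance of the jumps. -/
noncomputable def halfVariance (p a : ι → ℝ) : ℝ :=
  1 / 2 * ∑ j, a j ^ 2 * p j - 1 / 2 * (∑ j, a j * p j) ^ 2

theorem sum_sum_sq_sub (hp1 : ∑ j, p j = 1) :
    ∑ i, ∑ j, p i * p j * (a i - a j) ^ 2 = 4 * halfVariance p a := by
  have : ∀ i, ∑ j, p i * p j * (a i - a j) ^ 2 =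
      a i ^ 2 * p i - 2 * (a i * p i) * ∑ j, a j * p j + p i * ∑ j, a j ^ 2 * p j := by
    intro i
    calc _ = ∑ j, (a i ^ 2 * p i * p j - 2 * (a i * p i) * (a j * p j) + p i * (a j ^ 2 * p j)) :=
          Finset.sum_congr rfl fun j _ => by ring
      _ = _ := by
        rw [Finset.sum_add_distrib, Finset.sum_sub_distrib, ← Finset.mul_sum, ← Finset.mul_sum,
          ← Finset.mul_sum, hp1, mul_one]
  simp_rw [this]
  rw [Finset.sum_add_distrib, Finset.sum_sub_distrib, ← Finset.sum_mul, ← Finset.sum_mul,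
    ← Finset.mul_sum, hp1, halfVariance]
  ring

theorem norm_charSum_le_one (hp : ∀ j, 0 < p j) (hp1 : ∑ j, p j = 1) (k : ℝ) :
    ‖charSum p a k‖ ≤ 1 := by
  rw [← hp1]
  refine norm_sum_le_of_le _ fun j _ => ?_
  have : -(Complex.I * k * a j) = ((-(k * a j) : ℝ) : ℂ) * Complex.I := by push_cast; ring
  rw [norm_mul, this, Complex.norm_exp_ofReal_mul_I, mul_one, Complex.norm_real,
    Real.norm_eq_abs, abs_of_pos (hp j)]

theorem abs_normSq_charSum_sub_le (hp : ∀ j, 0 < p j) (hp1 : ∑ j, p j = 1) {R k : ℝ}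
    (ha : ∀ j, |a j| ≤ R) (hk : 2 * R * |k| ≤ 1) :
    |‖charSum p a k‖ ^ 2 - (1 - 2 * halfVariance p a * k ^ 2)| ≤ R ^ 4 * k ^ 4 := by
  have hmain : 1 - 2 * halfVariance p a * k ^ 2 =
      ∑ i, ∑ j, p i * p j * (1 - (k * (a i - a j)) ^ 2 / 2) := by
    have h1 : ∑ i, ∑ j, p i * p j = 1 := by rw [← Finset.sum_mul_sum, hp1, one_mul]
    have h2 := sum_sum_sq_sub (a := a) hp1
    calc _ = ∑ i, ∑ j, p i * p j - k ^ 2 / 2 * ∑ i, ∑ j, p i * p j * (a i - a j) ^ 2 := by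
          rw [h1, h2]; ring
      _ = _ := by
          rw [Finset.mul_sum, ← Finset.sum_sub_distrib]
          refine Finset.sum_congr rfl fun i _ => ?_
          rw [Finset.mul_sum, ← Finset.sum_sub_distrib]
          exact Finset.sum_congr rfl fun j _ => by ring
  have hk4 : |k| ^ 4 = k ^ 4 := (even_iff_two_dvd.mpr ⟨2, rfl⟩ : Even 4).pow_abs k
  rw [normSq_charSum, hmain, ← Finset.sum_sub_distrib]
  have hterm : ∀ i j, |p i * p j * Real.cos (k * (a i - a j)) -
      p i * p j * (1 - (k * (a i - a j)) ^ 2 / 2)| ≤ p i * p j * (R ^ 4 * k ^ 4) := by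
    intro i j
    have hx : |k * (a i - a j)| ≤ 2 * R * |k| := by
      rw [abs_mul, mul_comm]
      refine mul_le_mul_of_nonneg_right ((abs_sub _ _).trans ?_) (abs_nonneg _)
      linarith [ha i, ha j]
    have hc := Real.cos_bound (hx.trans hk)
    rw [← mul_sub, abs_mul, abs_of_pos (mul_pos (hp i) (hp j))]
    refine mul_le_mul_of_nonneg_left (hc.trans ?_) (mul_pos (hp i) (hp j)).le
    calc |k * (a i - a j)| ^ 4 * (5 / 96) ≤ (2 * R * |k|) ^ 4 * (5 / 96) := by gcongr
      _ = (80 / 96) * (R ^ 4 * |k| ^ 4) := by ring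
      _ ≤ R ^ 4 * |k| ^ 4 := mul_le_of_le_one_left (by positivity) (by norm_num)
      _ = _ := by rw [hk4]
  calc _ ≤ ∑ i, ∑ j, p i * p j * (R ^ 4 * k ^ 4) := by
        refine (Finset.abs_sum_le_sum_abs _ _).trans (Finset.sum_le_sum fun i _ => ?_)
        rw [← Finset.sum_sub_distrib]
        exact (Finset.abs_sum_le_sum_abs _ _).trans (Finset.sum_le_sum fun j _ => hterm i j)
    _ = R ^ 4 * k ^ 4 := by
        simp_rw [← Finset.sum_mul, ← Finset.sum_mul_sum, hp1, one_mul]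

/-- The logarithm is taken through `x ^ 2`, the quantity whose expansion is known, with `1 - 1 / y ≤
log y ≤ y - 1`; the lower bound `1 / 2` controls the inverse. -/
theorem neg_log_mem_of_sq {x : ℝ} (hx0 : 0 < x) (hx : 1 / 2 ≤ x ^ 2) :
    |-Real.log x - (1 - x ^ 2) / 2| ≤ (1 - x ^ 2) ^ 2 := by
  have hlog : Real.log (x ^ 2) = 2 * Real.log x := by rw [Real.log_pow]; norm_num
  have h1 := Real.log_le_sub_one_of_pos (show 0 < x ^ 2 by positivity)
  have h2 := Real.one_sub_inv_le_log_of_pos (show 0 < x ^ 2 by positivity)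
  have h3 : -(1 - x ^ 2) - 2 * (1 - x ^ 2) ^ 2 ≤ 1 - (x ^ 2)⁻¹ := by
    have : (x ^ 2)⁻¹ ≤ 1 + (1 - x ^ 2) + 2 * (1 - x ^ 2) ^ 2 := by
      rw [inv_le_iff_one_le_mul₀ (by positivity)]
      nlinarith [mul_nonneg (sq_nonneg (1 - x ^ 2)) (by linarith : 0 ≤ 2 * x ^ 2 - 1)]
    linarith
  rw [hlog] at h1 h2
  rw [abs_le]
  constructor <;> nlinarith [sq_nonneg (1 - x ^ 2)]

end Moments

theorem eventually_mul_abs_pow_lt (A : ℝ) {B : ℝ} (hB : 0 < B) (n : ℕ) (hn : n ≠ 0) :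
    ∀ᶠ k : ℝ in 𝓝 0, A * |k| ^ n < B := by
  have : Tendsto (fun k : ℝ => A * |k| ^ n) (𝓝 0) (𝓝 (A * |(0 : ℝ)| ^ n)) :=
    (by fun_prop : Continuous fun k : ℝ => A * |k| ^ n).tendsto 0
  rw [abs_zero, zero_pow hn, mul_zero] at this
  exact this.eventually (gt_mem_nhds hB)

/-! ### Coefficients of the de Rham equation at small wavenumber. -/

section Moments

variable {ι : Type*} [Fintype ι] {p a : ι → ℝ} {R : ℝ}

theorem norm_exp_neg_I_mul (k x : ℝ) : ‖Complex.exp (-(Complex.I * k * x))‖ = 1 := by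
  have : -(Complex.I * k * x) = ((-(k * x) : ℝ) : ℂ) * Complex.I := by push_cast; ring
  rw [this, Complex.norm_exp_ofReal_mul_I]

theorem norm_exp_neg_I_mul_sub_one_le (k : ℝ) {x : ℝ} (hx : |x| ≤ R) :
    ‖Complex.exp (-(Complex.I * k * x)) - 1‖ ≤ R * |k| := by
  have : -(Complex.I * k * x) = Complex.I * ((-(k * x) : ℝ) : ℂ) := by push_cast; ring
  rw [this]
  refine Real.norm_exp_I_mul_ofReal_sub_one_le.trans ?_
  rw [Real.norm_eq_abs, abs_neg, abs_mul, mul_comm]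
  exact mul_le_mul_of_nonneg_right hx (abs_nonneg k)

theorem norm_charSum_sub_one_le (hp : ∀ j, 0 < p j) (hp1 : ∑ j, p j = 1) (ha : ∀ j, |a j| ≤ R)
    (k : ℝ) : ‖charSum p a k - 1‖ ≤ R * |k| := by
  have h1 : charSum p a k - 1 = ∑ j, (p j : ℂ) * (Complex.exp (-(Complex.I * k * a j)) - 1) := by
    simp_rw [mul_sub, Finset.sum_sub_distrib, mul_one]
    rw [← Complex.ofReal_sum, hp1, Complex.ofReal_one, charSum]
  rw [h1]
  calc _ ≤ ∑ j, p j * (R * |k|) := by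
        refine norm_sum_le_of_le _ fun j _ => ?_
        rw [norm_mul, Complex.norm_real, Real.norm_eq_abs, abs_of_pos (hp j)]
        exact mul_le_mul_of_nonneg_left (norm_exp_neg_I_mul_sub_one_le k (ha j)) (hp j).le
    _ = R * |k| := by rw [← Finset.sum_mul, hp1, one_mul]

theorem one_sub_le_norm_charSum (hp : ∀ j, 0 < p j) (hp1 : ∑ j, p j = 1) (ha : ∀ j, |a j| ≤ R)
    (k : ℝ) : 1 - R * |k| ≤ ‖charSum p a k‖ := by
  have h1 := norm_charSum_sub_one_le hp hp1 ha k
  have h2 := norm_sub_norm_le (1 : ℂ) (1 - charSum p a k)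
  rw [sub_sub_cancel, norm_one, norm_sub_rev] at h2
  linarith

/-- The coefficient of the de Rham equation. -/
noncomputable def coeff (p a : ι → ℝ) (k : ℝ) (j : ι) : ℂ :=
  (p j : ℂ) / charSum p a k * Complex.exp (-(Complex.I * k * a j))

theorem sum_coeff {k : ℝ} (h : charSum p a k ≠ 0) : ∑ j, coeff p a k j = 1 := by
  simp_rw [coeff, div_mul_eq_mul_div]
  rw [← Finset.sum_div]
  exact div_self h

theorem norm_coeff (hp : ∀ j, 0 < p j) (k : ℝ) (j : ι) :
    ‖coeff p a k j‖ = p j / ‖charSum p a k‖ := by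
  rw [coeff, norm_mul, norm_exp_neg_I_mul, mul_one, norm_div, Complex.norm_real,
    Real.norm_eq_abs, abs_of_pos (hp j)]

theorem norm_exp_sub_charSum_le (hp : ∀ j, 0 < p j) (hp1 : ∑ j, p j = 1) (ha : ∀ j, |a j| ≤ R)
    (k : ℝ) (j : ι) :
    ‖Complex.exp (-(Complex.I * k * a j)) - charSum p a k‖ ≤ 2 * (R * |k|) := by
  have h1 := norm_charSum_sub_one_le hp hp1 ha k
  have h2 := norm_exp_neg_I_mul_sub_one_le k (ha j)
  rw [norm_sub_rev] at h1
  calc _ = ‖(Complex.exp (-(Complex.I * k * a j)) - 1) + (1 - charSum p a k)‖ := by ring_nf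
    _ ≤ _ := (norm_add_le _ _).trans (by linarith)

theorem sum_norm_coeff_sub_le (hp : ∀ j, 0 < p j) (hp1 : ∑ j, p j = 1) (ha : ∀ j, |a j| ≤ R)
    {k : ℝ} (hχ : 1 / 2 ≤ ‖charSum p a k‖) :
    ∑ j, ‖coeff p a k j - p j‖ ≤ 4 * (R * |k|) := by
  have hχ0 : charSum p a k ≠ 0 := norm_pos_iff.mp (by linarith)
  calc _ ≤ ∑ j, p j * (4 * (R * |k|)) := by
        refine Finset.sum_le_sum fun j _ => ?_
        have : coeff p a k j - p j = (p j : ℂ) *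
            ((Complex.exp (-(Complex.I * k * a j)) - charSum p a k) / charSum p a k) := by
          rw [coeff]; field_simp
        rw [this, norm_mul, Complex.norm_real, Real.norm_eq_abs, abs_of_pos (hp j), norm_div]
        refine mul_le_mul_of_nonneg_left ?_ (hp j).le
        have h1 := norm_exp_sub_charSum_le hp hp1 ha k j
        rw [div_le_iff₀ (by linarith)]
        have h2 : 0 ≤ 2 * (R * |k|) := (norm_nonneg _).trans h1
        nlinarith
    _ = _ := by rw [← Finset.sum_mul, hp1, one_mul]

theorem norm_coeff_div_norm_sub_one_le (hp : ∀ j, 0 < p j) (hp1 : ∑ j, p j = 1)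
    (ha : ∀ j, |a j| ≤ R) {k : ℝ} (hχ : 1 / 2 ≤ ‖charSum p a k‖) (j : ι) :
    ‖coeff p a k j / ‖coeff p a k j‖ - 1‖ ≤ 6 * R * |k| := by
  have hχpos : 0 < ‖charSum p a k‖ := by linarith
  have hχ0 : charSum p a k ≠ 0 := norm_pos_iff.mp hχpos
  have hpj : (p j : ℂ) ≠ 0 := by exact_mod_cast (hp j).ne'
  have hχn : (‖charSum p a k‖ : ℂ) ≠ 0 := by exact_mod_cast hχpos.ne'
  set E := Complex.exp (-(Complex.I * k * a j)) with hE
  -- The numerator is at most `R * |k| + 2 * (R * |k|)` and the denominator at least `1 / 2`, whence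
  -- the factor 6.
  have heq : coeff p a k j / ‖coeff p a k j‖ - 1 =
      (E * (((‖charSum p a k‖ - 1 : ℝ)) : ℂ) + (E - charSum p a k)) / charSum p a k := by
    rw [norm_coeff hp, coeff, ← hE]
    push_cast
    field_simp
    ring
  have h1 := norm_exp_sub_charSum_le hp hp1 ha k j
  have h2 : |‖charSum p a k‖ - 1| ≤ R * |k| := by
    have := abs_norm_sub_norm_le (charSum p a k) 1
    rw [norm_one] at this
    exact this.trans (norm_charSum_sub_one_le hp hp1 ha k)
  have h3 : 0 ≤ R * |k| := (abs_nonneg _).trans h2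
  rw [heq, norm_div, div_le_iff₀ hχpos]
  refine (norm_add_le _ _).trans ?_
  rw [norm_mul, norm_exp_neg_I_mul, one_mul, Complex.norm_real, Real.norm_eq_abs]
  nlinarith

/-- The similarity dimension up to fourth order in the wavenumber. -/
theorem eventually_abs_exponent_sub_le [Nonempty ι] (hp : ∀ j, 0 < p j) (hp1 : ∑ j, p j = 1)
    (ha : ∀ j, |a j| ≤ R) {ρ : ℝ} (hρ : ρ < 1) (hpρ : ∀ j, p j ≤ ρ) :
    ∃ C, ∀ᶠ k : ℝ in 𝓝 0, ∀ d : ℝ, 1 ≤ d → ∑ j, ‖coeff p a k j‖ ^ d = 1 →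
      |d - (1 + halfVariance p a / (∑ j, p j * Real.log (1 / p j)) * k ^ 2)| ≤ C * k ^ 4 := by
  have hρ0 : 0 < ρ := (hp (Classical.arbitrary ι)).trans_le (hpρ _)
  have hR0 : 0 ≤ R := (abs_nonneg _).trans (ha (Classical.arbitrary ι))
  set D := halfVariance p a with hD
  set lam := ∑ j, p j * Real.log (1 / p j) with hlam
  set ℓ := -Real.log ρ with hℓ
  have hℓ0 : 0 < ℓ := neg_pos.mpr (Real.log_neg hρ0 hρ)
  have hpℓ : ∀ j, ℓ ≤ -Real.log (p j) := fun j =>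
    neg_le_neg (Real.log_le_log (hp j) (hpρ j))
  have hlam0 : 0 < lam := Finset.sum_pos (fun j _ => mul_pos (hp j) (by
    rw [one_div, Real.log_inv]; exact hℓ0.trans_le (hpℓ j))) Finset.univ_nonempty
  -- With `x = ‖χ‖` and `L = -log x`: `V` bounds `(1 - x²) / k²`, `C₁` bounds `|L - D k²| / k⁴`,
  -- `C₂` bounds `L / k²`, and `C₃` is the constant of `abs_exponent_sub_le`.
  set V := 2 * |D| + R ^ 4 with hV
  set C₁ := R ^ 4 / 2 + V ^ 2 with hC₁
  set C₂ := |D| + C₁ with hC₂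
  set C₃ := 4 + 2 / ℓ + (∑ j, p j * Real.log (p j) ^ 2) * (2 / ℓ) ^ 2 with hC₃
  have hV0 : 0 ≤ V := by positivity
  have hC₁0 : 0 ≤ C₁ := by positivity
  have hC₂0 : 0 ≤ C₂ := by positivity
  have hC₃0 : 0 ≤ C₃ := by
    have : 0 ≤ ∑ j, p j * Real.log (p j) ^ 2 :=
      Finset.sum_nonneg fun j _ => mul_nonneg (hp j).le (sq_nonneg _)
    positivity
  refine ⟨(C₁ + C₃ * C₂ ^ 2) / lam, ?_⟩
  filter_upwards [eventually_mul_abs_pow_lt 1 one_pos 1 one_ne_zero,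
    eventually_mul_abs_pow_lt (4 * R) one_pos 1 one_ne_zero,
    eventually_mul_abs_pow_lt (2 * C₂) hℓ0 2 two_ne_zero] with k hk1 hkR hkℓ d hd hroot
  rw [pow_one] at hk1 hkR
  rw [sq_abs] at hkℓ
  have hk4 : k ^ 4 ≤ k ^ 2 := by
    have : k ^ 2 ≤ 1 := by rw [sq_le_one_iff_abs_le_one]; linarith
    nlinarith [sq_nonneg k]
  have hk20 := sq_nonneg k
  set x := ‖charSum p a k‖ with hx
  have hx1 : x ≤ 1 := norm_charSum_le_one hp hp1 k
  have hx2 := one_sub_le_norm_charSum hp hp1 ha k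
  have hx0 : 0 < x := by linarith
  have hxsq : 1 / 2 ≤ x ^ 2 := by nlinarith
  have hv := abs_normSq_charSum_sub_le hp hp1 (a := a) (k := k) ha (by
    nlinarith [mul_nonneg hR0 (abs_nonneg k)])
  rw [← hx, ← hD] at hv
  set v := 1 - x ^ 2 with hvdef
  have hv1 : |v - 2 * D * k ^ 2| ≤ R ^ 4 * k ^ 4 := by
    rw [abs_sub_comm] at hv
    convert hv using 2
    rw [hvdef]; ring
  have hv0 : 0 ≤ v := by rw [hvdef]; nlinarith
  have hDk : |D * k ^ 2| = |D| * k ^ 2 := by rw [abs_mul, abs_of_nonneg hk20]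
  have hvV : v ≤ V * k ^ 2 := by
    have h1 := (abs_le.mp hv1).2
    have h2 := le_abs_self (D * k ^ 2)
    have h3 : R ^ 4 * k ^ 4 ≤ R ^ 4 * k ^ 2 := mul_le_mul_of_nonneg_left hk4 (by positivity)
    rw [hV, add_mul]
    linarith
  set L := -Real.log x with hL
  have hL0 : 0 ≤ L := neg_nonneg.mpr (Real.log_nonpos hx0.le hx1)
  have hL1 : |L - D * k ^ 2| ≤ C₁ * k ^ 4 := by
    have h1 := neg_log_mem_of_sq hx0 hxsq
    have h2 : v ^ 2 ≤ V ^ 2 * k ^ 4 := by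
      calc v ^ 2 ≤ (V * k ^ 2) ^ 2 := by gcongr
        _ = _ := by ring
    calc |L - D * k ^ 2| = |(L - v / 2) + (v - 2 * D * k ^ 2) / 2| := by ring_nf
      _ ≤ |L - v / 2| + |(v - 2 * D * k ^ 2) / 2| := abs_add_le _ _
      _ ≤ V ^ 2 * k ^ 4 + R ^ 4 * k ^ 4 / 2 := by
        refine add_le_add (h1.trans h2) ?_
        rw [abs_div, abs_two]
        linarith
      _ = _ := by rw [hC₁]; ring
  have hL2 : L ≤ C₂ * k ^ 2 := by
    have h1 := (abs_le.mp hL1).2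
    have h2 := le_abs_self (D * k ^ 2)
    have h3 : C₁ * k ^ 4 ≤ C₁ * k ^ 2 := mul_le_mul_of_nonneg_left hk4 hC₁0
    rw [hC₂, add_mul]
    linarith
  have hroot' : ∑ j, p j ^ d = Real.exp (-(L * d)) := by
    have h1 : ∀ j, ‖coeff p a k j‖ ^ d = p j ^ d / x ^ d := fun j => by
      rw [norm_coeff hp, Real.div_rpow (hp j).le hx0.le]
    simp_rw [h1] at hroot
    rw [← Finset.sum_div, div_eq_one_iff_eq (Real.rpow_pos_of_pos hx0 d).ne'] at hroot
    rw [hroot, Real.rpow_def_of_pos hx0, hL]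
    ring_nf
  have hmain := abs_exponent_sub_le hp hp1 hℓ0 hpℓ hL0 (by linarith) hd hroot'
  rw [← hlam, ← hC₃] at hmain
  have hL3 : C₃ * L ^ 2 ≤ C₃ * C₂ ^ 2 * k ^ 4 := by
    calc C₃ * L ^ 2 ≤ C₃ * (C₂ * k ^ 2) ^ 2 := by gcongr
      _ = _ := by ring
  have heq : d - (1 + D / lam * k ^ 2) = ((lam * (d - 1) - L) + (L - D * k ^ 2)) / lam := by
    field_simp
    ring
  rw [heq, abs_div, abs_of_pos hlam0, div_mul_eq_mul_div, div_le_div_iff_of_pos_right hlam0]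
  refine (abs_add_le _ _).trans ?_
  linarith

end Moments

/-- Existence of the curve and the expansions of its two dimensions. -/
theorem eventually_exists_curve {ι : Type*} [Fintype ι] [LinearOrder ι] [Nonempty ι]
    {h p a : ι → ℝ} {R ρ : ℝ} (h0 : ∀ j, 0 < h j) (h1 : ∑ j, h j = 1) (hp : ∀ j, 0 < p j)
    (hp1 : ∑ j, p j = 1) (hR : 0 < R) (ha : ∀ j, |a j| ≤ R) (hρ : ρ < 1) (hpρ : ∀ j, p j ≤ ρ)
    (hhρ : ∀ j, h j ≤ ρ) :
    ∃ C, ∀ᶠ k : ℝ in 𝓝 0, charSum p a k ≠ 0 ∧ (∀ j, ‖coeff p a k j‖ ≤ (1 + ρ) / 2) ∧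
      ∃ F, IsDeRhamCurve h (coeff p a k) F ∧ ∃ d : ℝ, ∑ j, ‖coeff p a k j‖ ^ d = 1 ∧
        |(dimH (F '' Icc 0 1)).toReal
          - (1 + halfVariance p a / (∑ j, p j * Real.log (1 / p j)) * k ^ 2)| ≤ C * k ^ 4 ∧
        |d - (1 + halfVariance p a / (∑ j, p j * Real.log (1 / p j)) * k ^ 2)| ≤ C * k ^ 4 := by
  have hρ0 : 0 < ρ := (hp (Classical.arbitrary ι)).trans_le (hpρ _)
  -- A ratio between `ρ` and 1 leaves room for the division by `‖χ‖`, which is slightly less than 1.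
  set σ := (1 + ρ) / 2 with hσ
  have hσ0 : 0 < σ := by linarith
  have hσ1 : σ < 1 := by linarith
  obtain ⟨b₀, hb₀⟩ := Finite.exists_min p
  have hbot : IsMin (Finset.univ.min' (Finset.univ_nonempty (α := ι))) :=
    fun i _ => Finset.min'_le _ i (Finset.mem_univ i)
  have htop : IsMax (Finset.univ.max' (Finset.univ_nonempty (α := ι))) :=
    fun i _ => Finset.le_max' _ i (Finset.mem_univ i)
  obtain ⟨C₁, hC₁⟩ := eventually_abs_exponent_sub_le hp hp1 ha hρ hpρ
  obtain ⟨C₂, hC₂0, hC₂⟩ := exists_length_pow_le (A := 6 * R) (by positivity) hσ0.le hσ1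
  have hlog : 0 < Real.log σ⁻¹ := Real.log_pos ((one_lt_inv₀ hσ0).mpr hσ1)
  refine ⟨C₁ + 4 * C₂ / Real.log σ⁻¹, ?_⟩
  filter_upwards [hC₁, eventually_mul_abs_pow_lt (12 * (6 * R)) one_pos 1 one_ne_zero,
    eventually_mul_abs_pow_lt (2 * R) (sub_pos.mpr hρ) 1 one_ne_zero,
    eventually_mul_abs_pow_lt (4 * (4 * R)) (mul_pos (hp b₀) (sub_pos.mpr hσ1)) 1 one_ne_zero,
    eventually_mul_abs_pow_lt (4 * C₂) one_pos 4 four_ne_zero] with k hd hk1 hk2 hk3 hk4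
  rw [pow_one] at hk1 hk2 hk3
  have hkabs : |k| ^ 4 = k ^ 4 := (even_iff_two_dvd.mpr ⟨2, rfl⟩ : Even 4).pow_abs k
  rw [hkabs] at hk4
  have hx1 : ‖charSum p a k‖ ≤ 1 := norm_charSum_le_one hp hp1 k
  have hx2 := one_sub_le_norm_charSum hp hp1 ha k
  have hχ : 1 / 2 ≤ ‖charSum p a k‖ := by linarith
  have hχ0 : charSum p a k ≠ 0 := norm_pos_iff.mp (by linarith)
  have hxρ : ρ ≤ σ * ‖charSum p a k‖ := by
    have : ρ ≤ σ * (1 - R * |k|) := by nlinarith [mul_nonneg hR.le (abs_nonneg k)]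
    nlinarith
  have hcσ : ∀ j, ‖coeff p a k j‖ ≤ σ := fun j => by
    rw [norm_coeff hp, div_le_iff₀ (by linarith)]
    exact (hpρ j).trans hxρ
  have hcsum := sum_coeff hχ0
  obtain ⟨F, hF⟩ := exists_isDeRhamCurve h0 h1 hcsum hσ1 hcσ
  obtain ⟨d, hd1, hdsum⟩ := exists_critical_exponent hp hp1 (x := ‖charSum p a k‖) (by linarith)
    hx1 (fun j => by nlinarith [hpρ j])
  have hdsum' : ∑ j, ‖coeff p a k j‖ ^ d = 1 := by
    rw [← hdsum]
    exact Finset.sum_congr rfl fun j _ => by rw [norm_coeff hp]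
  have hd2 := hd d hd1 hdsum'
  refine ⟨hχ0, hcσ, F, hF, d, hdsum', ?_, ?_⟩
  · have hup := hF.dimH_le h0 h1 hσ1 hσ0.le hcσ (by linarith) hdsum'.le
    have hup' : (dimH (F '' Icc 0 1)).toReal ≤ d := ENNReal.toReal_le_of_le_ofReal (by linarith) hup
    have hfin : dimH (F '' Icc 0 1) ≠ ⊤ := ne_top_of_le_ne_top ENNReal.ofReal_ne_top hup
    have hlow : d - 4 * C₂ / Real.log σ⁻¹ * k ^ 4 ≤ (dimH (F '' Icc 0 1)).toReal := by
      -- At `k = 0` the expansion forces `d = 1`, and the trivial lower bound for the dimension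
      -- suffices.
      rcases eq_or_ne k 0 with rfl | hk
      · have h1 := (ENNReal.toReal_le_toReal ENNReal.one_ne_top hfin).mpr hF.one_le_dimH
        norm_num at hd2
        rw [ENNReal.toReal_one] at h1
        norm_num
        linarith
      · obtain ⟨M, hM1, hMη, hMσ⟩ := hC₂ k hk (by linarith)
        have := hF.le_dimH h0 h1 hcsum
          (fun j => norm_pos_iff.mp (by rw [norm_coeff hp]; exact div_pos (hp j) (by linarith)))
          hp hp1 (sum_norm_coeff_sub_le hp hp1 ha hχ) hσ0 hσ1
          (fun j => (hhρ j).trans (by linarith)) hcσ (hp b₀) hb₀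
          (by
            rw [← mul_div_assoc, div_le_iff₀ (sub_pos.mpr hσ1)]
            linarith)
          hbot htop (norm_coeff_div_norm_sub_one_le hp hp1 ha hχ) hM1 hMη (by linarith) hd1 hdsum'
        rw [ENNReal.ofReal_le_iff_le_toReal hfin] at this
        refine le_trans ?_ this
        have : 4 * σ ^ M / Real.log σ⁻¹ ≤ 4 * C₂ / Real.log σ⁻¹ * k ^ 4 := by
          rw [div_mul_eq_mul_div]
          exact div_le_div_of_nonneg_right (by linarith) hlog.le
        linarith
    have := abs_le.mp hd2
    rw [abs_le]
    constructor <;> nlinarith [this.1, this.2, show 0 ≤ 4 * C₂ / Real.log σ⁻¹ * k ^ 4 by positivity]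
  · refine hd2.trans ?_
    have : 0 ≤ 4 * C₂ / Real.log σ⁻¹ * k ^ 4 := by positivity
    linarith

/-- The symbols of the multi-baker map. -/
abbrev Hop (r : ℕ) : Type := {j : ℤ // j ∈ hops r}

theorem mem_hops_iff {r : ℕ} {j : ℤ} :
    j ∈ hops r ↔ (-((r / 2 : ℕ) : ℤ) ≤ j ∧ j ≤ ((r / 2 : ℕ) : ℤ)) ∧ (¬ Odd r → j ≠ 0) := by
  rw [hops]
  split_ifs with h
  · simp [h]
  · rw [Finset.mem_erase, Finset.mem_Icc]
    tauto

theorem neg_mem_hops {r : ℕ} {j : ℤ} (hj : j ∈ hops r) : -j ∈ hops r := by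
  rw [mem_hops_iff] at hj ⊢
  exact ⟨⟨by linarith [hj.1.2], by linarith [hj.1.1]⟩, fun h => neg_ne_zero.mpr (hj.2 h)⟩

theorem one_mem_hops {r : ℕ} (hr : 2 ≤ r) : (1 : ℤ) ∈ hops r := by
  rw [mem_hops_iff]
  omega

theorem abs_le_of_mem_hops {r : ℕ} {j : ℤ} (hj : j ∈ hops r) : |(j : ℝ)| ≤ r := by
  rw [mem_hops_iff] at hj
  have : |j| ≤ r := by rw [abs_le]; omega
  exact_mod_cast this

/-! ### Sums over the hops. -/

section Sums

variable {E : Type*} [AddCommMonoid E] (r : ℕ)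

theorem sum_hop (g : ℤ → E) : ∑ j : Hop r, g j = ∑ j ∈ hops r, g j :=
  Finset.sum_coe_sort (hops r) g

theorem sum_hop_neg (g : ℤ → E) : ∑ j : Hop r, g (-j) = ∑ j ∈ hops r, g j := by
  rw [sum_hop r fun j => g (-j)]
  exact Finset.sum_nbij' (fun j => -j) (fun j => -j) (fun _ => neg_mem_hops)
    (fun _ => neg_mem_hops) (fun _ _ => neg_neg _) (fun _ _ => neg_neg _) fun _ _ => rfl

theorem lowerSum_hop (g : ℤ → E) (j : Hop r) :
    lowerSum (fun i : Hop r => g i) j = ∑ i ∈ below r j, g i := by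
  rw [lowerSum, below, Finset.sum_filter, Finset.sum_filter,
    ← sum_hop r fun i => if i < j then g i else 0]
  rfl

end Sums

/-! ### The multi-baker map and its de Rham curve. -/

section Bridge

variable {r : ℕ} {p : ℤ → ℝ}

theorem xLeft_eq (j : Hop r) : xLeft r p j = lowerSum (fun i : Hop r => p i) j :=
  (lowerSum_hop r p j).symm

theorem yLeft_eq (j : Hop r) : yLeft r p j = lowerSum (fun i : Hop r => p (-i)) j :=
  (lowerSum_hop r (fun i => p (-i)) j).symm

/-- The coefficients of the de Rham equation of the multi-baker map. -/
noncomputable abbrev hopCoeff (r : ℕ) (p : ℤ → ℝ) (k : ℝ) (j : Hop r) : ℂ :=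
  coeff (fun i : Hop r => p i) (fun i : Hop r => ((i : ℤ) : ℝ)) k j

theorem chi_eq (k : ℝ) :
    chi r p k = charSum (fun i : Hop r => p i) (fun i : Hop r => ((i : ℤ) : ℝ)) k := by
  rw [chi, ← sum_hop r fun j : ℤ => (p j : ℂ) * Complex.exp (-(Complex.I * k * j)), charSum]
  simp only [Complex.ofReal_intCast]

theorem hopCoeff_eq (k : ℝ) (j : Hop r) :
    hopCoeff r p k j = (p j : ℂ) / chi r p k * Complex.exp (-(Complex.I * k * (j : ℤ))) := by
  rw [hopCoeff, coeff, chi_eq, Complex.ofReal_intCast]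

theorem lowerSum_hopCoeff (k : ℝ) (j : Hop r) :
    lowerSum (hopCoeff r p k) j =
      ∑ i ∈ below r j, (p i : ℂ) / chi r p k * Complex.exp (-(Complex.I * k * i)) := by
  rw [← lowerSum_hop r fun i : ℤ => (p i : ℂ) / chi r p k * Complex.exp (-(Complex.I * k * i))]
  exact Finset.sum_congr rfl fun i _ => hopCoeff_eq k i

theorem diffusion_eq :
    diffusion r p = halfVariance (fun i : Hop r => p i) (fun i : Hop r => ((i : ℤ) : ℝ)) := by
  rw [diffusion, halfVariance, sum_hop r fun j : ℤ => (j : ℝ) ^ 2 * p j,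
    sum_hop r fun j : ℤ => (j : ℝ) * p j]

theorem lyapunov_eq : lyapunov r p = ∑ j : Hop r, p j * Real.log (1 / p j) :=
  (sum_hop r fun j : ℤ => p j * Real.log (1 / p j)).symm

variable {k : ℝ} {F G : ℝ → ℂ}

theorem IsDeRhamCurve.isDeRhamSolution (hp : ∀ j ∈ hops r, 0 < p j)
    (hF : IsDeRhamCurve (fun i : Hop r => p (-i)) (hopCoeff r p k) F) :
    IsDeRhamSolution r p k F := by
  refine ⟨hF.continuousOn, hF.one, fun j hj y hy hy' => ?_⟩
  have hpj : 0 < p (-j) := hp _ (neg_mem_hops hj)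
  have := hF.map_cell ⟨j, hj⟩ ((y - yLeft r p j) / p (-j))
    ⟨div_nonneg (by linarith) hpj.le, by rw [div_le_one hpj]; linarith⟩
  rw [← yLeft_eq, lowerSum_hopCoeff, hopCoeff_eq] at this
  rw [← this]
  congr 1
  field_simp
  ring

theorem IsDeRhamSolution.eqOn (hp : ∀ j ∈ hops r, 0 < p j) (hsum : ∑ j ∈ hops r, p j = 1)
    (hF : IsDeRhamCurve (fun i : Hop r => p (-i)) (hopCoeff r p k) F) {ρ : ℝ} (hρ : ρ < 1)
    (hρ0 : 0 ≤ ρ) (hcρ : ∀ j, ‖hopCoeff r p k j‖ ≤ ρ) (hG : IsDeRhamSolution r p k G) :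
    EqOn G F (Icc 0 1) := by
  refine hF.eqOn (fun j => hp _ (neg_mem_hops j.2)) ((sum_hop_neg r p).trans hsum) hρ hρ0 hcρ
    hG.1 hG.2.1 fun j t ht => ?_
  have hpj : 0 < p (-j) := hp _ (neg_mem_hops j.2)
  have := hG.2.2 j j.2 (yLeft r p j + p (-j) * t)
    (le_add_of_nonneg_right (mul_nonneg hpj.le ht.1))
    (by have := mul_lt_of_lt_one_right hpj ht.2; linarith)
  rw [← yLeft_eq, lowerSum_hopCoeff, hopCoeff_eq, this, add_sub_cancel_left,
    mul_div_cancel_left₀ _ hpj.ne']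

theorem hopAt_eq (hp : ∀ j ∈ hops r, 0 < p j) {j : ℤ} (hj : j ∈ hops r) {x : ℝ}
    (hx : xLeft r p j ≤ x) (hx' : x < xLeft r p j + p j) : hopAt r p x = j := by
  rw [hopAt, Finset.sum_eq_single_of_mem j hj, if_pos ⟨hx, hx'⟩]
  intro i hi hij
  refine if_neg fun hcon => hij ?_
  have := eq_of_mem_cell (a := fun i : Hop r => p i) (fun i => (hp i i.2).le)
    (i := ⟨i, hi⟩) (j := ⟨j, hj⟩) (y := x)
  simp only [← xLeft_eq] at this
  exact congrArg Subtype.val (this hcon.1 hcon.2 hx hx')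

theorem cell_bounds (hp : ∀ j ∈ hops r, 0 < p j) (hsum : ∑ j ∈ hops r, p j = 1) {j : ℤ}
    (hj : j ∈ hops r) : 0 ≤ xLeft r p j ∧ xLeft r p j + p j ≤ 1 ∧ 0 ≤ yLeft r p j ∧
      yLeft r p j + p (-j) ≤ 1 := by
  have h1 := lowerSum_nonneg (a := fun i : Hop r => p i) (fun i => (hp i i.2).le) ⟨j, hj⟩
  have h2 := lowerSum_add_le_sum (a := fun i : Hop r => p i) (fun i => (hp i i.2).le) ⟨j, hj⟩
  have h3 := lowerSum_nonneg (a := fun i : Hop r => p (-i))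
    (fun i => (hp _ (neg_mem_hops i.2)).le) ⟨j, hj⟩
  have h4 := lowerSum_add_le_sum (a := fun i : Hop r => p (-i))
    (fun i => (hp _ (neg_mem_hops i.2)).le) ⟨j, hj⟩
  rw [sum_hop_neg r p] at h4
  rw [sum_hop r p] at h2
  rw [← xLeft_eq] at h1 h2
  rw [← yLeft_eq] at h3 h4
  rw [hsum] at h2 h4
  exact ⟨h1, h2, h3, h4⟩

/-- The preimage of a rectangle in a horizontal strip. -/
theorem preimage_rect (hp : ∀ j ∈ hops r, 0 < p j) (hsum : ∑ j ∈ hops r, p j = 1) {j : ℤ}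
    (hj : j ∈ hops r) (n : ℤ) {a b c d : ℝ} (ha : 0 ≤ a) (hb : b ≤ 1) (hc : yLeft r p j ≤ c)
    (hd : d ≤ yLeft r p j + p (-j)) :
    phase ∩ bakerMap r p ⁻¹' rect n a b c d =
      rect (n - j) (xLeft r p j + p j * a) (xLeft r p j + p j * b)
        ((c - yLeft r p j) / p (-j)) ((d - yLeft r p j) / p (-j)) := by
  have hpj := hp j hj
  have hqj := hp _ (neg_mem_hops hj)
  obtain ⟨hx0, hx1, -, -⟩ := cell_bounds hp hsum hj
  ext ⟨m, x, y⟩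
  simp only [phase, rect, bakerMap, mem_inter_iff, mem_prod, mem_univ, true_and, mem_preimage,
    mem_singleton_iff, mem_Ico]
  constructor
  · rintro ⟨⟨⟨hx, hx'⟩, hy, hy'⟩, hm, ⟨ha', hb'⟩, hc', hd'⟩
    obtain ⟨i, hi, hi'⟩ := exists_mem_cell (a := fun i : Hop r => p i) hx
      (by rw [sum_hop r p, hsum]; exact hx')
    rw [← xLeft_eq] at hi hi'
    rw [hopAt_eq hp i.2 hi hi'] at hm ha' hb' hc' hd'
    have hqi := hp _ (neg_mem_hops i.2)
    -- The vertical strip `i` is mapped into the horizontal strip `i`, and horizontal strips are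
    -- disjoint.
    have hij : i = ⟨j, hj⟩ := by
      refine eq_of_mem_cell (a := fun i : Hop r => p (-i))
        (fun i => (hp _ (neg_mem_hops i.2)).le) (y := yLeft r p i + p (-i) * y) ?_ ?_ ?_ ?_ <;>
        rw [← yLeft_eq]
      · exact le_add_of_nonneg_right (mul_nonneg hqi.le hy)
      · have := mul_lt_of_lt_one_right hqi hy'
        linarith
      · exact hc.trans hc'
      · exact hd'.trans_le hd
    subst hij
    simp only at hm ha' hb' hc' hd' hi hi'
    rw [le_div_iff₀ hpj] at ha'
    rw [div_lt_iff₀ hpj] at hb'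
    refine ⟨by linarith, ⟨by linarith, by linarith⟩, ?_, ?_⟩
    · rw [div_le_iff₀ hqj]; linarith
    · rw [lt_div_iff₀ hqj]; linarith
  · rintro ⟨hm, ⟨ha', hb'⟩, hc', hd'⟩
    have hpa := mul_nonneg hpj.le ha
    have hpb := mul_le_of_le_one_right hpj.le hb
    have hh := hopAt_eq hp hj (x := x) (by linarith) (by linarith)
    rw [hh]
    have hc0 : 0 ≤ (c - yLeft r p j) / p (-j) := div_nonneg (by linarith) hqj.le
    have hd1 : (d - yLeft r p j) / p (-j) ≤ 1 := by rw [div_le_one hqj]; linarith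
    refine ⟨⟨⟨by linarith, by linarith⟩, by linarith, by linarith⟩, by linarith, ⟨?_, ?_⟩, ?_, ?_⟩
    · rw [le_div_iff₀ hpj]; linarith
    · rw [div_lt_iff₀ hpj]; linarith
    · rw [div_le_iff₀ hqj] at hc'; linarith
    · rw [lt_div_iff₀ hqj] at hd'; linarith

/-- Rectangles of full width, from the bottom of horizontal strip `j` of cell 0 up to relative
height `t`, suffice: the preimage is the vertical strip `j` of cell `-j` up to height `t`, so
invariance reads `e^{-ikj} p_j G(t) = χ_k` times the increment of `G`. -/
theorem IsHydrodynamicMode.isDeRhamCurve (hp : ∀ j ∈ hops r, 0 < p j)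
    (hsum : ∑ j ∈ hops r, p j = 1) (hχ : chi r p k ≠ 0) (hG : IsHydrodynamicMode r p k G) :
    IsDeRhamCurve (fun i : Hop r => p (-i)) (hopCoeff r p k) G := by
  obtain ⟨hGc, hG0, hG1, hGm⟩ := hG
  refine IsDeRhamCurve.of_increments hGc hG0 hG1 fun j t ht => ?_
  have hpj := hp j j.2
  have hqj := hp _ (neg_mem_hops j.2)
  obtain ⟨hx0, hx1, hy0, hy1⟩ := cell_bounds hp hsum j.2
  have hqt := mul_nonneg hqj.le ht.1
  have hqt' := mul_le_of_le_one_right hqj.le ht.2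
  have hpre := preimage_rect hp hsum j.2 0 (a := 0) (b := 1) (c := yLeft r p j)
    (d := yLeft r p j + p (-j) * t) le_rfl le_rfl le_rfl (by linarith)
  rw [sub_self, zero_div, add_sub_cancel_left, mul_div_cancel_left₀ _ hqj.ne', mul_zero, add_zero,
    mul_one, zero_sub] at hpre
  have := hGm 0 (-j) 0 1 (yLeft r p j) (yLeft r p j + p (-j) * t) (xLeft r p j)
    (xLeft r p j + p j) 0 t le_rfl zero_le_one le_rfl hy0 (by linarith) (by linarith) hx0
    (by linarith) hx1 le_rfl ht.1 ht.2 hpre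
  rw [modeCharge, modeCharge, hG0, add_sub_cancel_left] at this
  rw [← yLeft_eq, hopCoeff_eq]
  push_cast at this
  rw [mul_zero, Complex.exp_zero, sub_zero, sub_zero, one_mul, one_mul, mul_neg] at this
  rw [div_mul_eq_mul_div, div_mul_eq_mul_div, eq_div_iff hχ, mul_comm, ← this]
  ring

theorem rect_eq_empty_iff {n : ℤ} {a b c d : ℝ} : rect n a b c d = ∅ ↔ b ≤ a ∨ d ≤ c := by
  simp [rect, Set.prod_eq_empty_iff, Set.Ico_eq_empty_iff]

theorem modeCharge_eq_zero {n : ℤ} {a b c d : ℝ} (h : a = b ∨ c = d) :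
    modeCharge k F n a b c d = 0 := by
  rcases h with rfl | rfl <;> simp [modeCharge]

theorem Ico_endpoints_eq {a b a' b' : ℝ} (h : a < b) (heq : Ico a b = Ico a' b') :
    a = a' ∧ b = b' := by
  have hne : (Ico a' b').Nonempty := heq ▸ nonempty_Ico.mpr h
  have h' := nonempty_Ico.mp hne
  constructor
  · rw [← csInf_Ico h, heq, csInf_Ico h']
  · rw [← csSup_Ico h, heq, csSup_Ico h']

theorem rect_inj {n n' : ℤ} {a b c d a' b' c' d' : ℝ} (hab : a < b) (hcd : c < d)
    (h : rect n a b c d = rect n' a' b' c' d') :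
    n = n' ∧ a = a' ∧ b = b' ∧ c = c' ∧ d = d' := by
  have hne : (Ico a b ×ˢ Ico c d).Nonempty := (nonempty_Ico.mpr hab).prod (nonempty_Ico.mpr hcd)
  have h1 := (Set.prod_eq_prod_iff_of_nonempty ((singleton_nonempty n).prod hne)).mp h
  have h2 := (Set.prod_eq_prod_iff_of_nonempty hne).mp h1.2
  exact ⟨singleton_injective h1.1, (Ico_endpoints_eq hab h2.1).1, (Ico_endpoints_eq hab h2.1).2,
    (Ico_endpoints_eq hcd h2.2).1, (Ico_endpoints_eq hcd h2.2).2⟩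

theorem exists_yLeft_cell (hsum : ∑ j ∈ hops r, p j = 1) {y : ℝ}
    (hy : 0 ≤ y) (hy' : y < 1) : ∃ j ∈ hops r, yLeft r p j ≤ y ∧ y < yLeft r p j + p (-j) := by
  obtain ⟨j, hj, hj'⟩ := exists_mem_cell (a := fun i : Hop r => p (-i)) hy
    (by rw [sum_hop_neg r p, hsum]; exact hy')
  rw [← yLeft_eq] at hj hj'
  exact ⟨j, j.2, hj, hj'⟩

/-- A rectangle whose preimage lies in a single cell does not cross the strips. -/
theorem le_of_preimage_subset (hp : ∀ j ∈ hops r, 0 < p j) (hsum : ∑ j ∈ hops r, p j = 1)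
    {n m : ℤ} {a b c d a' b' c' d' : ℝ} (ha : 0 ≤ a) (hab : a < b) (hb : b ≤ 1) (hd : d ≤ 1)
    (hpre : phase ∩ bakerMap r p ⁻¹' rect n a b c d = rect m a' b' c' d') {j : ℤ}
    (hj : j ∈ hops r) (hc : yLeft r p j ≤ c) (hc' : c < yLeft r p j + p (-j)) (hcd : c < d) :
    d ≤ yLeft r p j + p (-j) := by
  -- Each strip `i` met by the rectangle has preimage points in cell `n - i`; a single cell `m`
  -- allows only one strip.
  have hcell : ∀ i ∈ hops r, ∀ y, c ≤ y → y < d → yLeft r p i ≤ y → y < yLeft r p i + p (-i) →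
      m = n - i := by
    intro i hi y hy hy' hyi hyi'
    have hsub : rect n a b y (min d (yLeft r p i + p (-i))) ⊆ rect n a b c d :=
      Set.prod_mono_right (Set.prod_mono_right (Set.Ico_subset_Ico hy (min_le_left _ _)))
    have h1 := inter_subset_inter_right phase (preimage_mono (f := bakerMap r p) hsub)
    rw [hpre, preimage_rect hp hsum hi n ha hb hyi (min_le_right _ _)] at h1
    have hqi := hp _ (neg_mem_hops hi)
    have hpi := hp _ hi
    have hmem : (n - i, xLeft r p i + p i * a, (y - yLeft r p i) / p (-i)) ∈
        rect m a' b' c' d' := by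
      refine h1 ⟨rfl, ⟨le_rfl, ?_⟩, le_rfl, ?_⟩
      · exact add_lt_add_right (mul_lt_mul_of_pos_left hab hpi) _
      · exact div_lt_div_of_pos_right (sub_lt_sub_right (lt_min hy' hyi') _) hqi
    exact (mem_singleton_iff.mp hmem.1).symm
  by_contra! hcon
  obtain ⟨-, -, hy0, -⟩ := cell_bounds hp hsum hj
  have hqj := hp _ (neg_mem_hops hj)
  obtain ⟨i, hi, hi1, hi2⟩ := exists_yLeft_cell hsum (y := yLeft r p j + p (-j))
    (by linarith) (by linarith)
  have h1 := hcell j hj c le_rfl hcd hc hc'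
  have h2 := hcell i hi _ hc'.le hcon hi1 hi2
  have : i = j := by linarith
  subst this
  exact lt_irrefl _ hi2

/-- By `le_of_preimage_subset` a nonempty test rectangle lies in one strip `j`. Its preimage is then
explicit, with width scaled by `p j` and phase shifted by `e^{-ikj}`, which the coefficient in the
increment of `F` compensates up to `χ_k`. -/
theorem IsDeRhamCurve.isHydrodynamicMode (hp : ∀ j ∈ hops r, 0 < p j)
    (hsum : ∑ j ∈ hops r, p j = 1) (hχ : chi r p k ≠ 0)
    (hF : IsDeRhamCurve (fun i : Hop r => p (-i)) (hopCoeff r p k) F) :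
    IsHydrodynamicMode r p k F := by
  refine ⟨hF.continuousOn, hF.zero, hF.one, ?_⟩
  intro n m a b c d a' b' c' d' ha hab hb hc hcd hd ha' hab' hb' hc' hcd' hd' hpre
  by_cases hdeg : a = b ∨ c = d
  -- An empty rectangle does not determine its end points, so both charges are shown to vanish.
  · have hemp : rect n a b c d = ∅ := rect_eq_empty_iff.mpr (hdeg.imp (fun h => h.ge) fun h => h.ge)
    rw [hemp, preimage_empty, inter_empty, eq_comm, rect_eq_empty_iff] at hpre
    rw [modeCharge_eq_zero hdeg, modeCharge_eq_zero
      (hpre.imp (fun h => le_antisymm hab' h) fun h => le_antisymm hcd' h), mul_zero]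
  · rw [not_or] at hdeg
    have hab0 := lt_of_le_of_ne hab hdeg.1
    have hcd0 := lt_of_le_of_ne hcd hdeg.2
    obtain ⟨j, hj, hcj, hcj'⟩ := exists_yLeft_cell hsum hc (hcd0.trans_le hd)
    have hdj := le_of_preimage_subset hp hsum ha hab0 hb hd hpre hj hcj hcj' hcd0
    rw [preimage_rect hp hsum hj n ha hb hcj hdj] at hpre
    have hqj := hp _ (neg_mem_hops hj)
    have hpj := hp _ hj
    obtain ⟨rfl, rfl, rfl, rfl, rfl⟩ := rect_inj
      (add_lt_add_right (mul_lt_mul_of_pos_left hab0 hpj) _)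
      (div_lt_div_of_pos_right (sub_lt_sub_right hcd0 _) hqj) hpre
    have hval : ∀ y, yLeft r p j ≤ y → y ≤ yLeft r p j + p (-j) →
        F y = lowerSum (hopCoeff r p k) ⟨j, hj⟩ +
          hopCoeff r p k ⟨j, hj⟩ * F ((y - yLeft r p j) / p (-j)) := by
      intro y hy hy'
      have := hF.map_cell ⟨j, hj⟩ ((y - yLeft r p j) / p (-j))
        ⟨div_nonneg (by linarith) hqj.le, by rw [div_le_one hqj]; linarith⟩
      rw [← yLeft_eq] at this
      rw [← this]
      congr 1
      field_simp
      ring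
    rw [modeCharge, modeCharge, hval d (hcj.trans hcd) hdj, hval c hcj (hcd.trans hdj),
      hopCoeff_eq, add_sub_add_left_eq_sub, ← mul_sub]
    have hexp : Complex.exp (Complex.I * k * ((n - j : ℤ) : ℂ)) =
        Complex.exp (Complex.I * k * n) * Complex.exp (-(Complex.I * k * j)) := by
      rw [← Complex.exp_add]
      push_cast
      ring_nf
    rw [hexp]
    push_cast
    field_simp
    ring

theorem IsDeRhamCurve.cylinderSum_eq (hp : ∀ j ∈ hops r, 0 < p j)
    (hsum : ∑ j ∈ hops r, p j = 1)
    (hF : IsDeRhamCurve (fun i : Hop r => p (-i)) (hopCoeff r p k) F) (s : ℝ) (l : ℕ) :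
    cylinderSum r p F s l = (∑ j, ‖hopCoeff r p k j‖ ^ s) ^ l := by
  rw [cylinderSum, ← sum_wordRatio_rpow]
  refine Finset.sum_congr rfl fun w _ => ?_
  have hw : ∀ t, wordPoint r p w t =
      MultiBaker.wordMap (fun i : Hop r => p (-i)) (List.ofFn w) t := by
    intro t
    simp only [wordPoint, MultiBaker.wordMap, yLeft_eq]
  have h0 : ∀ j : Hop r, 0 < p (-j) := fun j => hp _ (neg_mem_hops j.2)
  have h1 : ∑ j : Hop r, p (-j) = 1 := (sum_hop_neg r p).trans hsum
  rw [hw, hw, hF.wordMap h0 h1 _ (right_mem_Icc.mpr zero_le_one),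
    hF.wordMap h0 h1 _ (left_mem_Icc.mpr zero_le_one), ← dist_eq_norm, dist_curveMap, hF.one,
    hF.zero, dist_zero_right, norm_one, mul_one]

/-- The cylinder sums are geometric in `l`, with a base that decreases strictly in `s` and equals 1
at `d`. -/
theorem IsDeRhamCurve.isCylinderDimension (hr : 2 ≤ r) (hp : ∀ j ∈ hops r, 0 < p j)
    (hsum : ∑ j ∈ hops r, p j = 1)
    (hF : IsDeRhamCurve (fun i : Hop r => p (-i)) (hopCoeff r p k) F)
    (hc0 : ∀ j, 0 < ‖hopCoeff r p k j‖) (hc1 : ∀ j, ‖hopCoeff r p k j‖ < 1) {d : ℝ}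
    (hd : ∑ j, ‖hopCoeff r p k j‖ ^ d = 1) : IsCylinderDimension r p F d := by
  have hne : (Finset.univ : Finset (Hop r)).Nonempty := ⟨⟨1, one_mem_hops hr⟩, Finset.mem_univ _⟩
  constructor <;> intro s hs
  · have : 1 < ∑ j, ‖hopCoeff r p k j‖ ^ s := by
      rw [← hd]
      exact Finset.sum_lt_sum_of_nonempty hne fun j _ =>
        Real.rpow_lt_rpow_of_exponent_gt (hc0 j) (hc1 j) hs
    exact (tendsto_pow_atTop_atTop_of_one_lt this).congr fun l =>
      (hF.cylinderSum_eq hp hsum s l).symm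
  · have : ∑ j, ‖hopCoeff r p k j‖ ^ s < 1 := by
      rw [← hd]
      exact Finset.sum_lt_sum_of_nonempty hne fun j _ =>
        Real.rpow_lt_rpow_of_exponent_gt (hc0 j) (hc1 j) hs
    have h0 : 0 ≤ ∑ j, ‖hopCoeff r p k j‖ ^ s :=
      Finset.sum_nonneg fun j _ => Real.rpow_nonneg (norm_nonneg _) _
    exact (tendsto_pow_atTop_nhds_zero_of_lt_one h0 this).congr fun l =>
      (hF.cylinderSum_eq hp hsum s l).symm

/-- Both 1 and -1 are hops, so no single hop carries the full probability. -/
theorem exists_hop_bound (hr : 2 ≤ r) (hp : ∀ j ∈ hops r, 0 < p j)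
    (hsum : ∑ j ∈ hops r, p j = 1) : ∃ ρ < 1, ∀ j ∈ hops r, p j ≤ ρ := by
  have h1 := one_mem_hops hr
  obtain ⟨j₀, hj₀, hmax⟩ := (hops r).exists_max_image p ⟨1, h1⟩
  refine ⟨p j₀, ?_, hmax⟩
  obtain ⟨i, hi, hij⟩ : ∃ i ∈ hops r, i ≠ j₀ := by
    by_cases h : j₀ = 1
    · exact ⟨-1, neg_mem_hops h1, by rw [h]; norm_num⟩
    · exact ⟨1, h1, Ne.symm h⟩
  rw [← hsum]
  exact Finset.single_lt_sum hij hj₀ hi (hp i hi) fun m hm _ => (hp m hm).le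

end Bridge

end MultiBaker

theorem theorem1 (r : ℕ) (hr : 2 ≤ r) (p : ℤ → ℝ)
    (hp : ∀ j ∈ MultiBaker.hops r, 0 < p j)
    (hsum : ∑ j ∈ MultiBaker.hops r, p j = 1) :
    ∃ k₀ > (0 : ℝ), ∃ (F : ℝ → ℝ → ℂ) (d : ℝ → ℝ),
      (∀ k : ℝ, |k| < k₀ →
        (∀ j ∈ MultiBaker.hops r, p j < ‖MultiBaker.chi r p k‖) ∧
        MultiBaker.IsHydrodynamicMode r p k (F k) ∧
        MultiBaker.IsDeRhamSolution r p k (F k) ∧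
        (∀ G : ℝ → ℂ,
          MultiBaker.IsHydrodynamicMode r p k G ∨ MultiBaker.IsDeRhamSolution r p k G →
          EqOn G (F k) (Icc 0 1)) ∧
        MultiBaker.IsCylinderDimension r p (F k) (d k) ∧
        ‖MultiBaker.chi r p k‖ ^ d k = ∑ j ∈ MultiBaker.hops r, p j ^ d k) ∧
      (fun k : ℝ => (dimH (F k '' Icc 0 1)).toReal
          - (1 + MultiBaker.diffusion r p / MultiBaker.lyapunov r p * k ^ 2))
        =O[𝓝 0] (fun k : ℝ => k ^ 4) ∧
      (fun k : ℝ => d k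
          - (1 + MultiBaker.diffusion r p / MultiBaker.lyapunov r p * k ^ 2))
        =O[𝓝 0] (fun k : ℝ => k ^ 4) := by
  open MultiBaker in
  obtain ⟨ρ, hρ1, hρ⟩ := exists_hop_bound hr hp hsum
  have hne : Nonempty (Hop r) := ⟨⟨1, one_mem_hops hr⟩⟩
  obtain ⟨C, hC⟩ := eventually_exists_curve (h := fun i : Hop r => p (-i))
    (p := fun i : Hop r => p i) (a := fun i : Hop r => ((i : ℤ) : ℝ)) (R := r)
    (fun j => hp _ (neg_mem_hops j.2)) ((sum_hop_neg r p).trans hsum) (fun j => hp j j.2)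
    ((sum_hop r p).trans hsum) (by positivity) (fun j => abs_le_of_mem_hops j.2) hρ1
    (fun j => hρ j j.2) (fun j => hρ _ (neg_mem_hops j.2))
  rw [← diffusion_eq, ← lyapunov_eq] at hC
  obtain ⟨k₀, hk₀, hball⟩ := Metric.eventually_nhds_iff.mp hC
  have hC' : ∀ k : ℝ, |k| < k₀ → _ := fun k hk => (hball (by simpa [Real.dist_eq] using hk)).2.2
  choose! F hF d hd hdim hdd using hC'
  refine ⟨k₀, hk₀, F, d, fun k hk => ?_, ?_, ?_⟩
  · obtain ⟨hχ, hcσ, -⟩ := hball (y := k) (by simpa [Real.dist_eq] using hk)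
    rw [← chi_eq] at hχ
    have hσ1 : (1 + ρ) / 2 < 1 := by linarith
    have hσ0 : 0 ≤ (1 + ρ) / 2 := (norm_nonneg _).trans (hcσ (Classical.arbitrary _))
    have hχ0 : 0 < ‖chi r p k‖ := norm_pos_iff.mpr hχ
    have hcn : ∀ j : Hop r, ‖hopCoeff r p k j‖ = p j / ‖chi r p k‖ := fun j => by
      rw [chi_eq]; exact norm_coeff (fun j : Hop r => hp j j.2) k j
    have hc1 : ∀ j, ‖hopCoeff r p k j‖ < 1 := fun j => (hcσ j).trans_lt hσ1
    refine ⟨fun j hj => ?_, (hF k hk).isHydrodynamicMode hp hsum hχ,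
      (hF k hk).isDeRhamSolution hp, ?_, (hF k hk).isCylinderDimension hr hp hsum
        (fun j => by rw [hcn]; exact div_pos (hp j j.2) hχ0) hc1 (hd k hk), ?_⟩
    · have := hc1 ⟨j, hj⟩
      rwa [hcn, div_lt_one hχ0] at this
    · rintro G (hG | hG)
      -- A mode is in particular a de Rham solution, so one uniqueness statement covers both cases.
      · exact ((hG.isDeRhamCurve hp hsum hχ).isDeRhamSolution hp).eqOn hp hsum (hF k hk) hσ1 hσ0
          hcσ
      · exact hG.eqOn hp hsum (hF k hk) hσ1 hσ0 hcσ
    · have := hd k hk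
      have hpow : ∀ j : Hop r, ‖hopCoeff r p k j‖ ^ d k = p j ^ d k / ‖chi r p k‖ ^ d k :=
        fun j => by rw [hcn, Real.div_rpow (hp j j.2).le hχ0.le]
      simp_rw [hpow] at this
      rw [← Finset.sum_div, div_eq_one_iff_eq (Real.rpow_pos_of_pos hχ0 _).ne',
        sum_hop r fun j => p j ^ d k] at this
      exact this.symm
  all_goals
    refine IsBigO.of_bound C ?_
    filter_upwards [Metric.ball_mem_nhds (0 : ℝ) hk₀] with k hk
    rw [Metric.mem_ball, Real.dist_eq, sub_zero] at hk
    rw [Real.norm_eq_abs, Real.norm_eq_abs, abs_of_nonneg (by positivity : 0 ≤ k ^ 4)]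
  · exact hdim k hk
  · exact hdd k hk
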